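/- Let $X$ be a real random variable with a probability density $p$ on $\mathbb R$. For $t>0$ let $X_t=X+Z_t$ with $Z_t\sim N(0,t)$ independent of $X$, and let $$p_t(x)=\frac1{\sqrt{2\pi t}}\int_{\mathbb R}p(y)\,e^{-(x-y)^2/(2t)}\,dy,\qquad H(X_t)=-\int_{\mathbb R}p_t(x)\log p_t(x)\,dx .$$ Assume that this entropy integral converges absolutely for at least one $t>0$. (a) For every $t>0$, $p_t$ is the density of $X_t$ and $H(X_t)$ is finite (the integral converges absolutely). The function $t\mapsto H(X_t)$ is three times continuously differentiable on $(0,\infty)$, and $D(3,1)$ holds: $$\frac{d^3}{dt^3}H(X_t)\ge 0\qquad (t>0).$$ (b) Fix $t>0$. Then $f=p_t$ is positive and five times continuously differentiable. Write $f_k$ for the $k$-th derivative of $f$, and put $m_1=f^2f_3$, $m_2=ff_1f_2$, $m_3=f_1^3$ and $$F_{3,1}=\tfrac14f^4f_3^2-\tfrac12f^3f_1f_2f_3+\tfrac14f^4f_1f_5+\tfrac14f^2f_1^2f_2^2-\tfrac18f^3f_1^2f_4,$$ $$\widehat F_{3,1}=\tfrac12m_1^2-m_1m_2-\tfrac12m_2^2+\tfrac35m_3^2,\qquad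 \widehat R_1=5m_2m_3-4m_3^2,\qquad \widehat R_2=m_1m_3+3m_2^2-\tfrac{12}5m_3^2 .$$ Then $F_{3,1}/f^5$, $\widehat F_{3,1}/f^5$, $\widehat R_1/f^5$, $\widehat R_2/f^5$ are integrable over $\mathbb R$ and $$\frac{d^3}{dt^3}H(X_t)=\int_{\mathbb R}\frac{F_{3,1}}{f^5}\,dx=\int_{\mathbb R}\frac{\widehat F_{3,1}}{f^5}\,dx,\qquad \int_{\mathbb R}\frac{\widehat R_1}{f^5}\,dx=\int_{\mathbb R}\frac{\widehat R_2}{f^5}\,dx=0 .$$ (c) As quadratic forms in three real variables $m_1,m_2,m_3$, the reduced form $\widehat F_{3,1}$ has, modulo the two quadratic constraints $\widehat R_1,\widehat R_2$, the rational sum-of-squares representation $$\widehat F_{3,1}=\tfrac{213}{1444}\widehat R_1-\tfrac{407}{1009}\widehat R_2+\tfrac{1}{2036162}(1009m_1-1009m_2+407m_3)^2+\tfrac{1}{1784109085952}(612256m_2-486877m_3)^2+\tfrac{69485907702371}{9000830338627840}\,m_3^2 .$$ -/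

import Mathlib

open MeasureTheory ProbabilityTheory

namespace EntropyD31

noncomputable section

/-- The integrand `-q(x) log q(x)` of the differential entropy of a real random variable `Y`,
where `q` is the density of `Y` with respect to Lebesgue measure. -/
def entropyIntegrand {Ω : Type*} [MeasurableSpace Ω] (P : Measure Ω) (Y : Ω → ℝ) (x : ℝ) : ℝ :=
  -((pdf Y P volume x).toReal * Real.log (pdf Y P volume x).toReal)

/-- The differential entropy `H(Y) = -∫ q log q` of a real random variable `Y` with density `q`. -/
def entropy {Ω : Type*} [MeasurableSpace Ω] (P : Measure Ω) (Y : Ω → ℝ) : ℝ :=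
  ∫ x, entropyIntegrand P Y x

/-- `p_t(x) = (2πt)^(-1/2) ∫ p(y) exp(-(x-y)²/(2t)) dy`, where `p` is the density of `X`. -/
def heatDensity {Ω : Type*} [MeasurableSpace Ω] (P : Measure Ω) (X : Ω → ℝ) (t x : ℝ) : ℝ :=
  1 / Real.sqrt (2 * Real.pi * t) *
    ∫ y, (pdf X P volume y).toReal * Real.exp (-(x - y) ^ 2 / (2 * t))

/-- `jet P X t x k` is `f_k(x)`, the `k`-th derivative in `x` of `f = p_t`. -/
def jet {Ω : Type*} [MeasurableSpace Ω] (P : Measure Ω) (X : Ω → ℝ) (t x : ℝ) (k : ℕ) : ℝ :=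
  iteratedDeriv k (heatDensity P X t) x

/-- The differential form `F_{3,1}`. -/
def formF (f : ℕ → ℝ) : ℝ :=
  1 / 4 * f 0 ^ 4 * f 3 ^ 2 - 1 / 2 * f 0 ^ 3 * f 1 * f 3 * f 2 + 1 / 4 * f 0 ^ 4 * f 1 * f 5
    + 1 / 4 * f 0 ^ 2 * f 1 ^ 2 * f 2 ^ 2 - 1 / 8 * f 0 ^ 3 * f 1 ^ 2 * f 4

/-- The reduced form: a quadratic form in three variables. -/
def reducedForm (m₁ m₂ m₃ : ℝ) : ℝ :=
  1 / 2 * m₁ ^ 2 - m₁ * m₂ - 1 / 2 * m₂ ^ 2 + 3 / 5 * m₃ ^ 2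

/-- The first quadratic constraint. -/
def constraintOne (_m₁ m₂ m₃ : ℝ) : ℝ :=
  5 * m₂ * m₃ - 4 * m₃ ^ 2

/-- The second quadratic constraint. -/
def constraintTwo (m₁ m₂ m₃ : ℝ) : ℝ :=
  m₁ * m₃ + 3 * m₂ ^ 2 - 12 / 5 * m₃ ^ 2

/-- A form `Q` in three variables, evaluated at the three monomials of degree 3 and total order 3,
`m₁ = f² f₃`, `m₂ = f f₁ f₂`, `m₃ = f₁³`. -/
def atMonomials (Q : ℝ → ℝ → ℝ → ℝ) (f : ℕ → ℝ) : ℝ :=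
  Q (f 0 ^ 2 * f 3) (f 0 * f 1 * f 2) (f 1 ^ 3)

end

end EntropyD31

namespace EntropyD31

noncomputable section

/-! Put `f = p_t` and `r_k = f_k / f`. The heat equation `∂_t f = f_2 / 2` gives de Bruijn's
identity `H' = (1/2) ∫ f r_1²` (`hasDerivAt_integral_negMulLog`). Two more time derivatives turn
`H'''` into the integral of `f` times a polynomial in the ratios of total order 6. Integrating exact
derivatives over the line removes `r_4` and `r_5` (`integral_fisherForm₂_eq_reducedForm`), leaving a
quadratic form in `r_3`, `r_1 r_2`, `r_1³`. Two further exact derivatives supply quadratic forms of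
integral zero, modulo which it is a sum of squares (`reducedForm_eq`).

The analytic work is domination. Let `M` be `f` with its kernel weighted by `(1 + |x - y|)^6`, and
let `N` be defined by `f N^6 = M`. Then `|r_k| ≤ C N^k` for `k ≤ 6` (`exists_abs_heatDeriv_le`), so
`f` times any polynomial in the ratios of total order at most 6 is bounded by a multiple of the
integrable `M`, locally uniformly in `t`. `HasOrder` records this bound and justifies every
differentiation under the integral and every integration by parts.

The logarithm in the first derivative is outside that scheme. It is controlled by a Harnack
inequality (`surprisal_add_le`), which converts finite entropy at one time into integrability of `M`
times the surprisal, and hence into finite entropy at all times. -/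

/-! ### The Gaussian kernel: recursion for its derivatives, heat equation, tail bounds. -/

/-- The `k`-th derivative in `u` of the density of the centred Gaussian of variance `t`. -/
def gaussDeriv (t u : ℝ) : ℕ → ℝ
  | 0 => 1 / Real.sqrt (2 * Real.pi * t) * Real.exp (-u ^ 2 / (2 * t))
  | 1 => -(u * gaussDeriv t u 0) / t
  | k + 2 => -(u * gaussDeriv t u (k + 1) + (k + 1) * gaussDeriv t u k) / t

lemma gaussDeriv_zero_pos {t : ℝ} (ht : 0 < t) (u : ℝ) : 0 < gaussDeriv t u 0 := by
  unfold gaussDeriv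
  positivity

/-- The exponential increases with the variance and the prefactor decreases, so one kernel dominates
a whole compact time interval; `sqrt (b / a)` is the quotient of the extreme prefactors. -/
lemma gaussDeriv_zero_le {a b t : ℝ} (ha : 0 < a) (hat : a ≤ t) (htb : t ≤ b) (u : ℝ) :
    gaussDeriv t u 0 ≤ Real.sqrt (b / a) * gaussDeriv b u 0 := by
  have hb : 0 < b := by linarith
  have ht : 0 < t := by linarith
  have h1 : Real.sqrt (b / a) * (1 / Real.sqrt (2 * Real.pi * b))
      = 1 / Real.sqrt (2 * Real.pi * a) := by
    rw [Real.sqrt_div hb.le, Real.sqrt_mul (by positivity) b, Real.sqrt_mul (by positivity) a]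
    field_simp
  unfold gaussDeriv
  rw [← mul_assoc, h1]
  have h2 : -u ^ 2 / (2 * t) ≤ -u ^ 2 / (2 * b) := by
    rw [neg_div, neg_div]
    gcongr
  gcongr

lemma hasDerivAt_gaussDeriv_space_zero (t u : ℝ) :
    HasDerivAt (fun u => gaussDeriv t u 0) (gaussDeriv t u 1) u := by
  have h : HasDerivAt (fun u : ℝ => -u ^ 2 / (2 * t)) (-(2 * u) / (2 * t)) u := by
    simpa using ((hasDerivAt_pow 2 u).neg.div_const (2 * t))
  have := (h.exp).const_mul (1 / Real.sqrt (2 * Real.pi * t))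
  simp only [gaussDeriv]
  refine this.congr_deriv ?_
  rw [← mul_neg, mul_div_mul_left _ _ (two_ne_zero' ℝ)]
  ring

lemma hasDerivAt_gaussDeriv_space (t : ℝ) (k : ℕ) (u : ℝ) :
    HasDerivAt (fun u => gaussDeriv t u k) (gaussDeriv t u (k + 1)) u := by
  induction k using Nat.twoStepInduction generalizing u with
  | zero => exact hasDerivAt_gaussDeriv_space_zero t u
  | one =>
    have := (((hasDerivAt_id u).mul (hasDerivAt_gaussDeriv_space_zero t u)).neg.div_const t)
    refine (this.congr_deriv ?_).congr_of_eventuallyEq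
      (Filter.Eventually.of_forall fun v => ?_)
    · simp [gaussDeriv]
      ring
    · simp [gaussDeriv]
  | more k h0 h1 =>
    have := ((((hasDerivAt_id u).mul (h1 u)).add ((h0 u).const_mul ((k : ℝ) + 1))).neg.div_const t)
    refine (this.congr_deriv ?_).congr_of_eventuallyEq
      (Filter.Eventually.of_forall fun v => ?_)
    · simp [gaussDeriv]
      ring
    · simp [gaussDeriv]

lemma continuous_gaussDeriv (t : ℝ) (k : ℕ) : Continuous fun u => gaussDeriv t u k :=
  continuous_iff_continuousAt.2 fun u => (hasDerivAt_gaussDeriv_space t k u).continuousAt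

lemma hasDerivAt_gaussDeriv_time_zero {t : ℝ} (ht : 0 < t) (u : ℝ) :
    HasDerivAt (fun t => gaussDeriv t u 0) (1 / 2 * gaussDeriv t u 2) t := by
  have hs : HasDerivAt (fun t : ℝ => 2 * Real.pi * t) (2 * Real.pi) t := by
    simpa using (hasDerivAt_id t).const_mul (2 * Real.pi)
  have h1 := (hs.sqrt (by positivity)).inv (by positivity)
  have h2 : HasDerivAt (fun t : ℝ => -u ^ 2 / (2 * t)) (u ^ 2 / (2 * t ^ 2)) t := by
    have h : HasDerivAt (fun t : ℝ => 2 * t) 2 t := by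
      simpa using (hasDerivAt_id t).const_mul 2
    refine ((hasDerivAt_const t (-u ^ 2)).div h (by positivity)).congr_deriv ?_
    field_simp
    ring
  simp only [gaussDeriv, one_div]
  refine HasDerivAt.congr_deriv (f := fun t : ℝ => (Real.sqrt (2 * Real.pi * t))⁻¹ *
    Real.exp (-u ^ 2 / (2 * t))) (h1.mul h2.exp) ?_
  have h3 : Real.sqrt (2 * Real.pi * t) ^ 2 = 2 * Real.pi * t := Real.sq_sqrt (by positivity)
  rw [h3]
  simp only [Nat.cast_zero, Pi.inv_apply]
  field_simp
  ring

/-- This is the heat equation, carried from `k = 0` to all `k` along the recursion; it trades one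
time derivative for two space derivatives. -/
lemma hasDerivAt_gaussDeriv_time {t : ℝ} (ht : 0 < t) (k : ℕ) (u : ℝ) :
    HasDerivAt (fun t => gaussDeriv t u k) (1 / 2 * gaussDeriv t u (k + 2)) t := by
  induction k using Nat.twoStepInduction with
  | zero => exact hasDerivAt_gaussDeriv_time_zero ht u
  | one =>
    have := ((hasDerivAt_gaussDeriv_time_zero ht u).const_mul u).neg.div
      (hasDerivAt_id t) ht.ne'
    refine (this.congr_deriv ?_).congr_of_eventuallyEq
      (Filter.Eventually.of_forall fun v => ?_)
    · simp [gaussDeriv]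
      field_simp
      ring
    · simp [gaussDeriv]
  | more k h0 h1 =>
    have := ((h1.const_mul u).add (h0.const_mul ((k : ℝ) + 1))).neg.div (hasDerivAt_id t) ht.ne'
    refine (this.congr_deriv ?_).congr_of_eventuallyEq
      (Filter.Eventually.of_forall fun v => ?_)
    · simp [gaussDeriv]
      field_simp
      ring
    · simp [gaussDeriv]

/-- Each step of the recursion costs at most a factor `1 + |u|` for each order and a factor `1 / t ≤
1 / a`, so the constant does not depend on `t ≥ a`. -/
lemma exists_abs_gaussDeriv_le {a : ℝ} (ha : 0 < a) (k : ℕ) :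
    ∃ C : ℝ, 0 ≤ C ∧ ∀ t, a ≤ t → ∀ u,
      |gaussDeriv t u k| ≤ C * ((1 + |u|) ^ k * gaussDeriv t u 0) := by
  induction k using Nat.twoStepInduction with
  | zero =>
    refine ⟨1, zero_le_one, fun t ht u => ?_⟩
    rw [abs_of_pos (gaussDeriv_zero_pos (ha.trans_le ht) u)]
    simp
  | one =>
    refine ⟨1 / a, by positivity, fun t ht u => ?_⟩
    have h := gaussDeriv_zero_pos (ha.trans_le ht) u
    have ht0 := ha.trans_le ht
    rw [show gaussDeriv t u 1 = -(u * gaussDeriv t u 0) / t from rfl, abs_div, abs_neg, abs_mul,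
      abs_of_pos h, abs_of_pos ht0, one_div, ← div_eq_inv_mul, pow_one]
    gcongr
    linarith [abs_nonneg u]
  | more k h0 h1 =>
    obtain ⟨C, hC, h0⟩ := h0
    obtain ⟨D, hD, h1⟩ := h1
    refine ⟨(D + (k + 1) * C) / a, by positivity, fun t ht u => ?_⟩
    have ht0 := ha.trans_le ht
    have hG := gaussDeriv_zero_pos ht0 u
    have hu := abs_nonneg u
    set G := gaussDeriv t u 0
    have e1 : |u| * |gaussDeriv t u (k + 1)| ≤ D * ((1 + |u|) ^ (k + 2) * G) :=
      calc |u| * |gaussDeriv t u (k + 1)|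
          ≤ (1 + |u|) * (D * ((1 + |u|) ^ (k + 1) * G)) := by
            gcongr
            · linarith
            · exact h1 t ht u
        _ = _ := by ring
    have e2 : ((k : ℝ) + 1) * |gaussDeriv t u k| ≤ (k + 1) * C * ((1 + |u|) ^ (k + 2) * G) :=
      calc ((k : ℝ) + 1) * |gaussDeriv t u k|
          ≤ (k + 1) * (C * ((1 + |u|) ^ k * G)) := by
            gcongr
            exact h0 t ht u
        _ ≤ (k + 1) * (C * ((1 + |u|) ^ (k + 2) * G)) := by
            gcongr
            · linarith
            · omega
        _ = _ := by ring
    rw [show gaussDeriv t u (k + 2)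
      = -(u * gaussDeriv t u (k + 1) + (k + 1) * gaussDeriv t u k) / t from rfl, abs_div, abs_neg,
      abs_of_pos ht0, div_mul_eq_mul_div]
    gcongr
    calc |u * gaussDeriv t u (k + 1) + (k + 1) * gaussDeriv t u k|
        ≤ |u| * |gaussDeriv t u (k + 1)| + (k + 1) * |gaussDeriv t u k| := by
          refine (abs_add_le _ _).trans ?_
          rw [abs_mul, abs_mul, abs_of_pos (by positivity : (0 : ℝ) < k + 1)]
      _ ≤ _ := (add_le_add e1 e2).trans_eq (by ring)

lemma weight_mul_gaussDeriv_le {b : ℝ} (hb : 0 < b) (m : ℕ) (u : ℝ) :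
    (1 + |u|) ^ m * gaussDeriv b u 0 ≤
      m.factorial * Real.exp (1 + b) / Real.sqrt (2 * Real.pi * b) *
        Real.exp (-(1 / (4 * b)) * u ^ 2) := by
  have h1 : (1 + |u|) ^ m ≤ m.factorial * Real.exp (1 + |u|) := by
    have := Real.pow_div_factorial_le_exp (1 + |u|) (by positivity) m
    rwa [div_le_iff₀ (by positivity), mul_comm] at this
  -- Half of the Gaussian exponent `u² / (2b)` is spent on absorbing the polynomial weight; the
  -- other half remains for integrability.
  have h2 : |u| ≤ u ^ 2 / (4 * b) + b := by
    have : u ^ 2 / (4 * b) + b - |u| = (|u| - 2 * b) ^ 2 / (4 * b) := by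
      rw [← sq_abs u]
      field_simp
      ring
    have h3 : 0 ≤ (|u| - 2 * b) ^ 2 / (4 * b) := by positivity
    linarith
  calc (1 + |u|) ^ m * gaussDeriv b u 0
      ≤ m.factorial * Real.exp (1 + (u ^ 2 / (4 * b) + b)) * gaussDeriv b u 0 := by
        refine mul_le_mul_of_nonneg_right (h1.trans ?_) (gaussDeriv_zero_pos hb u).le
        gcongr
    _ = _ := by
        have : Real.exp (1 + (u ^ 2 / (4 * b) + b)) * Real.exp (-u ^ 2 / (2 * b))
            = Real.exp (1 + b) * Real.exp (-(1 / (4 * b)) * u ^ 2) := by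
          rw [← Real.exp_add, ← Real.exp_add]
          congr 1
          field_simp
          ring
        unfold gaussDeriv
        linear_combination (m.factorial : ℝ) / Real.sqrt (2 * Real.pi * b) * this

lemma exists_weight_mul_gaussDeriv_le {b : ℝ} (hb : 0 < b) (m : ℕ) :
    ∃ C : ℝ, 0 ≤ C ∧ ∀ u, (1 + |u|) ^ m * gaussDeriv b u 0 ≤ C := by
  refine ⟨m.factorial * Real.exp (1 + b) / Real.sqrt (2 * Real.pi * b), by positivity,
    fun u => (weight_mul_gaussDeriv_le hb m u).trans ?_⟩
  refine mul_le_of_le_one_right (by positivity) (Real.exp_le_one_iff.2 ?_)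
  have : 0 ≤ 1 / (4 * b) * u ^ 2 := by positivity
  linarith

lemma continuous_weight_mul_gaussDeriv (b : ℝ) (m : ℕ) :
    Continuous fun u : ℝ => (1 + |u|) ^ m * gaussDeriv b u 0 := by
  have := continuous_gaussDeriv b 0
  fun_prop

lemma integrable_weight_mul_gaussDeriv {b : ℝ} (hb : 0 < b) (m : ℕ) :
    Integrable fun u : ℝ => (1 + |u|) ^ m * gaussDeriv b u 0 := by
  refine ((integrable_exp_neg_mul_sq (b := 1 / (4 * b)) (by positivity)).const_mul
    (m.factorial * Real.exp (1 + b) / Real.sqrt (2 * Real.pi * b))).mono'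
    (continuous_weight_mul_gaussDeriv b m).aestronglyMeasurable
    (Filter.Eventually.of_forall fun u => ?_)
  rw [Real.norm_of_nonneg (mul_nonneg (by positivity) (gaussDeriv_zero_pos hb u).le)]
  exact weight_mul_gaussDeriv_le hb m u

lemma exists_abs_gaussDeriv_le_const {a b : ℝ} (ha : 0 < a) (k : ℕ) :
    ∃ C : ℝ, 0 ≤ C ∧ ∀ t ∈ Set.Icc a b, ∀ u, |gaussDeriv t u k| ≤ C := by
  rcases le_or_gt a b with hab | hab
  swap
  · exact ⟨0, le_rfl, fun t ht => absurd (ht.1.trans ht.2) (not_le.2 hab)⟩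
  have hb : 0 < b := ha.trans_le hab
  obtain ⟨C, hC, h⟩ := exists_abs_gaussDeriv_le ha k
  obtain ⟨D, hD, h'⟩ := exists_weight_mul_gaussDeriv_le hb k
  refine ⟨C * (Real.sqrt (b / a) * D), by positivity, fun t ht u => (h t ht.1 u).trans ?_⟩
  refine mul_le_mul_of_nonneg_left ?_ hC
  calc (1 + |u|) ^ k * gaussDeriv t u 0
      ≤ (1 + |u|) ^ k * (Real.sqrt (b / a) * gaussDeriv b u 0) := by
        gcongr
        exact gaussDeriv_zero_le ha ht.1 ht.2 u
    _ = Real.sqrt (b / a) * ((1 + |u|) ^ k * gaussDeriv b u 0) := by ring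
    _ ≤ _ := by gcongr; exact h' u

/-! ### The heat flow of a probability measure, and pointwise bounds on its derivatives. -/

/-- The `k`-th spatial derivative of the density of `ν ∗ N(0, t)`. -/
def heatDeriv (ν : Measure ℝ) (k : ℕ) (t x : ℝ) : ℝ :=
  ∫ y, gaussDeriv t (x - y) k ∂ν

/-- The heat kernel weighted by `(1 + |x - y|) ^ 6`, integrated against `ν`. -/
def momentDensity (ν : Measure ℝ) (t x : ℝ) : ℝ :=
  ∫ y, (1 + |x - y|) ^ 6 * gaussDeriv t (x - y) 0 ∂ν

/-- The sixth root of the normalised sixth moment: it controls the ratio of the `k`-th derivative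
to the density itself by its `k`-th power. -/
def growth (ν : Measure ℝ) (t x : ℝ) : ℝ :=
  (momentDensity ν t x / heatDeriv ν 0 t x) ^ ((1 : ℝ) / 6)

section heat

variable (ν : Measure ℝ) [IsProbabilityMeasure ν]

lemma integrable_gaussDeriv_sub {t : ℝ} (ht : 0 < t) (k : ℕ) (x : ℝ) :
    Integrable (fun y => gaussDeriv t (x - y) k) ν := by
  obtain ⟨C, -, hC⟩ := exists_abs_gaussDeriv_le_const (b := t) ht k
  exact .of_bound ((continuous_gaussDeriv t k).comp
    (continuous_const.sub continuous_id)).aestronglyMeasurable C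
    (Filter.Eventually.of_forall fun y => hC t ⟨le_rfl, le_rfl⟩ _)

lemma integrable_weight_sub {t : ℝ} (ht : 0 < t) (m : ℕ) (x : ℝ) :
    Integrable (fun y => (1 + |x - y|) ^ m * gaussDeriv t (x - y) 0) ν := by
  obtain ⟨C, -, hC⟩ := exists_weight_mul_gaussDeriv_le ht m
  refine .of_bound ((continuous_weight_mul_gaussDeriv t m).comp
    (continuous_const.sub continuous_id)).aestronglyMeasurable C
    (Filter.Eventually.of_forall fun y => ?_)
  rw [Real.norm_of_nonneg (mul_nonneg (by positivity) (gaussDeriv_zero_pos ht _).le)]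
  exact hC _

lemma heatDeriv_zero_pos {t : ℝ} (ht : 0 < t) (x : ℝ) : 0 < heatDeriv ν 0 t x := by
  unfold heatDeriv
  rw [integral_pos_iff_support_of_nonneg (fun y => (gaussDeriv_zero_pos ht _).le)
    (integrable_gaussDeriv_sub ν ht 0 x)]
  have : Function.support (fun y => gaussDeriv t (x - y) 0) = Set.univ :=
    Function.support_eq_univ fun y => (gaussDeriv_zero_pos ht _).ne'
  simp [this]

/-- The kernel derivatives are bounded and `ν` is finite, so a constant dominates. -/
lemma hasDerivAt_heatDeriv_space {t : ℝ} (ht : 0 < t) (k : ℕ) (x : ℝ) :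
    HasDerivAt (heatDeriv ν k t) (heatDeriv ν (k + 1) t x) x := by
  obtain ⟨C, -, hC⟩ := exists_abs_gaussDeriv_le_const (b := t) ht (k + 1)
  exact (hasDerivAt_integral_of_dominated_loc_of_deriv_le (μ := ν) (s := Set.univ)
    (F := fun x y => gaussDeriv t (x - y) k) (F' := fun x y => gaussDeriv t (x - y) (k + 1))
    (bound := fun _ => C) Filter.univ_mem
    (Filter.Eventually.of_forall fun x => (integrable_gaussDeriv_sub ν ht k x).1)
    (integrable_gaussDeriv_sub ν ht k x) (integrable_gaussDeriv_sub ν ht (k + 1) x).1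
    (Filter.Eventually.of_forall fun y x _ => hC t ⟨le_rfl, le_rfl⟩ _) (integrable_const C)
    (Filter.Eventually.of_forall fun y x _ =>
      (hasDerivAt_gaussDeriv_space t k (x - y)).comp_sub_const x y)).2

lemma continuous_heatDeriv {t : ℝ} (ht : 0 < t) (k : ℕ) : Continuous (heatDeriv ν k t) :=
  continuous_iff_continuousAt.2 fun x => (hasDerivAt_heatDeriv_space ν ht k x).continuousAt

lemma hasDerivAt_heatDeriv_time {t : ℝ} (ht : 0 < t) (k : ℕ) (x : ℝ) :
    HasDerivAt (fun t => heatDeriv ν k t x) (1 / 2 * heatDeriv ν (k + 2) t x) t := by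
  obtain ⟨C, -, hC⟩ := exists_abs_gaussDeriv_le_const (b := 2 * t) (half_pos ht) (k + 2)
  have hs : Set.Icc (t / 2) (2 * t) ∈ nhds t := Icc_mem_nhds (by linarith) (by linarith)
  unfold heatDeriv
  rw [← integral_const_mul]
  refine (hasDerivAt_integral_of_dominated_loc_of_deriv_le (μ := ν)
    (F := fun t y => gaussDeriv t (x - y) k)
    (F' := fun t y => 1 / 2 * gaussDeriv t (x - y) (k + 2))
    (bound := fun _ => 1 / 2 * C) hs ?_
    (integrable_gaussDeriv_sub ν ht k x)
    ((integrable_gaussDeriv_sub ν ht (k + 2) x).const_mul _).1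
    (Filter.Eventually.of_forall fun y s hs => ?_) (integrable_const _)
    (Filter.Eventually.of_forall fun y s hs =>
      hasDerivAt_gaussDeriv_time ((half_pos ht).trans_le hs.1) k (x - y))).2
  · filter_upwards [hs] with s hs
    exact (integrable_gaussDeriv_sub ν ((half_pos ht).trans_le hs.1) k x).1
  · rw [norm_mul, Real.norm_of_nonneg (by norm_num : (0 : ℝ) ≤ 1 / 2)]
    exact mul_le_mul_of_nonneg_left (hC s hs _) (by norm_num)

/-- A translate of an integrable function is integrable against `volume × ν`. -/
lemma integrable_prod_comp_sub {h : ℝ → ℝ} (hc : Continuous h) (hi : Integrable h) :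
    Integrable (fun p : ℝ × ℝ => h (p.1 - p.2)) (volume.prod ν) := by
  rw [integrable_prod_iff' (by
    exact (hc.comp (continuous_fst.sub continuous_snd)).aestronglyMeasurable)]
  refine ⟨Filter.Eventually.of_forall fun y => hi.comp_sub_right y, ?_⟩
  have : (fun y => ∫ x, ‖h (x - y)‖) = fun _ => ∫ x, ‖h x‖ := by
    ext y
    exact integral_sub_right_eq_self (fun x => ‖h x‖) y
  simp only [this]
  exact integrable_const _

lemma integrable_momentDensity {t : ℝ} (ht : 0 < t) : Integrable (momentDensity ν t) :=
  (integrable_prod_comp_sub ν (continuous_weight_mul_gaussDeriv t 6)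
    (integrable_weight_mul_gaussDeriv ht 6)).integral_prod_left

lemma integrable_heatDeriv_zero {t : ℝ} (ht : 0 < t) : Integrable (heatDeriv ν 0 t) :=
  (integrable_prod_comp_sub ν (continuous_gaussDeriv t 0)
    (by simpa using integrable_weight_mul_gaussDeriv ht 0)).integral_prod_left

lemma heatDeriv_zero_le_momentDensity {t : ℝ} (ht : 0 < t) (x : ℝ) :
    heatDeriv ν 0 t x ≤ momentDensity ν t x := by
  refine integral_mono (integrable_gaussDeriv_sub ν ht 0 x) (integrable_weight_sub ν ht 6 x)
    fun y => ?_
  exact le_mul_of_one_le_left (gaussDeriv_zero_pos ht _).le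
    (one_le_pow₀ (by linarith [abs_nonneg (x - y)]))

lemma momentDensity_pos {t : ℝ} (ht : 0 < t) (x : ℝ) : 0 < momentDensity ν t x :=
  (heatDeriv_zero_pos ν ht x).trans_le (heatDeriv_zero_le_momentDensity ν ht x)

lemma momentDensity_le {a b t : ℝ} (ha : 0 < a) (hat : a ≤ t) (htb : t ≤ b) (x : ℝ) :
    momentDensity ν t x ≤ Real.sqrt (b / a) * momentDensity ν b x := by
  unfold momentDensity
  rw [← integral_const_mul]
  refine integral_mono (integrable_weight_sub ν (ha.trans_le hat) 6 x)
    ((integrable_weight_sub ν (ha.trans_le (hat.trans htb)) 6 x).const_mul _) fun y => ?_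
  simp only
  rw [mul_left_comm]
  exact mul_le_mul_of_nonneg_left (gaussDeriv_zero_le ha hat htb _) (by positivity)

lemma one_le_growth {t : ℝ} (ht : 0 < t) (x : ℝ) : 1 ≤ growth ν t x :=
  Real.one_le_rpow ((one_le_div (heatDeriv_zero_pos ν ht x)).2
    (heatDeriv_zero_le_momentDensity ν ht x)) (by norm_num)

lemma growth_pow_six {t : ℝ} (ht : 0 < t) (x : ℝ) :
    heatDeriv ν 0 t x * growth ν t x ^ 6 = momentDensity ν t x := by
  have h0 := heatDeriv_zero_pos ν ht x
  have h1 := momentDensity_pos ν ht x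
  rw [growth, ← Real.rpow_natCast, ← Real.rpow_mul (by positivity)]
  norm_num
  field_simp

/-- Apply `z^k ≤ 1 + z^6` to `z = (1 + |x - y|) / N`. The scale `N` is the one for which both
resulting terms equal `N^k f`, since `f N^6 = M`. -/
lemma integral_weight_le_growth {t : ℝ} (ht : 0 < t) {k : ℕ} (hk : k ≤ 6) (x : ℝ) :
    ∫ y, (1 + |x - y|) ^ k * gaussDeriv t (x - y) 0 ∂ν ≤
      2 * growth ν t x ^ k * heatDeriv ν 0 t x := by
  have hN : 0 < growth ν t x := zero_lt_one.trans_le (one_le_growth ν ht x)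
  set N := growth ν t x with hNdef
  have young : ∀ z : ℝ, 0 ≤ z → z ^ k ≤ 1 + z ^ 6 := fun z hz => by
    rcases le_total z 1 with h | h
    · have := pow_le_one₀ (n := k) hz h
      have := pow_nonneg hz 6
      linarith
    · have := pow_le_pow_right₀ h hk
      linarith
  calc ∫ y, (1 + |x - y|) ^ k * gaussDeriv t (x - y) 0 ∂ν
      ≤ ∫ y, (N ^ k * gaussDeriv t (x - y) 0
          + N ^ k / N ^ 6 * ((1 + |x - y|) ^ 6 * gaussDeriv t (x - y) 0)) ∂ν := by
        refine integral_mono (integrable_weight_sub ν ht k x)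
          (((integrable_gaussDeriv_sub ν ht 0 x).const_mul _).add
            ((integrable_weight_sub ν ht 6 x).const_mul _)) fun y => ?_
        have hG := gaussDeriv_zero_pos ht (x - y)
        have hz : 0 ≤ (1 + |x - y|) / N := by positivity
        have := mul_le_mul_of_nonneg_right
          (mul_le_mul_of_nonneg_left (young _ hz) (pow_pos hN k).le) hG.le
        rw [div_pow, div_pow, mul_div_cancel₀ _ (pow_pos hN k).ne'] at this
        refine this.trans_eq ?_
        ring
    _ = N ^ k * heatDeriv ν 0 t x + N ^ k / N ^ 6 * momentDensity ν t x := by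
        rw [integral_add ((integrable_gaussDeriv_sub ν ht 0 x).const_mul _)
            ((integrable_weight_sub ν ht 6 x).const_mul _), integral_const_mul,
          integral_const_mul]
        rfl
    _ = _ := by
        rw [← growth_pow_six ν ht x]
        field_simp
        ring

lemma exists_abs_heatDeriv_le {a : ℝ} (ha : 0 < a) {k : ℕ} (hk : k ≤ 6) :
    ∃ C : ℝ, 0 ≤ C ∧ ∀ t, a ≤ t → ∀ x,
      |heatDeriv ν k t x| ≤ C * growth ν t x ^ k * heatDeriv ν 0 t x := by
  obtain ⟨C, hC, h⟩ := exists_abs_gaussDeriv_le ha k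
  refine ⟨C * 2, by positivity, fun t ht x => ?_⟩
  have ht0 := ha.trans_le ht
  calc |heatDeriv ν k t x| ≤ ∫ y, |gaussDeriv t (x - y) k| ∂ν := abs_integral_le_integral_abs
    _ ≤ ∫ y, C * ((1 + |x - y|) ^ k * gaussDeriv t (x - y) 0) ∂ν :=
        integral_mono (integrable_gaussDeriv_sub ν ht0 k x).abs
          ((integrable_weight_sub ν ht0 k x).const_mul _) fun y => h t ht _
    _ ≤ C * (2 * growth ν t x ^ k * heatDeriv ν 0 t x) := by
        rw [integral_const_mul]
        exact mul_le_mul_of_nonneg_left (integral_weight_le_growth ν ht0 hk x) hC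
    _ = _ := by ring

end heat

/-! ### The order calculus: polynomials in the ratios of total order at most 6. -/

/-- The ratio of the `k`-th spatial derivative of the heat flow to the heat flow. -/
def heatRatio (ν : Measure ℝ) (k : ℕ) (t x : ℝ) : ℝ :=
  heatDeriv ν k t x / heatDeriv ν 0 t x

/-- A separately continuous function dominated by `growth ^ j`, locally uniformly in time. -/
structure HasOrder (ν : Measure ℝ) (j : ℕ) (q : ℝ → ℝ → ℝ) : Prop where
  bound : ∀ a b : ℝ, 0 < a → ∃ C : ℝ, 0 ≤ C ∧ ∀ t ∈ Set.Icc a b, ∀ x,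
    |q t x| ≤ C * growth ν t x ^ j
  continuous_space : ∀ t, 0 < t → Continuous (q t)
  continuousAt_time : ∀ t, 0 < t → ∀ x, ContinuousAt (fun t => q t x) t

section

variable {ν : Measure ℝ}

lemma HasOrder.add {j : ℕ} {p q : ℝ → ℝ → ℝ} (hp : HasOrder ν j p) (hq : HasOrder ν j q) :
    HasOrder ν j (fun t x => p t x + q t x) where
  bound a b ha := by
    obtain ⟨C, hC, h⟩ := hp.bound a b ha
    obtain ⟨D, hD, h'⟩ := hq.bound a b ha
    refine ⟨C + D, by positivity, fun t ht x => (abs_add_le _ _).trans ?_⟩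
    rw [add_mul]
    exact add_le_add (h t ht x) (h' t ht x)
  continuous_space t ht := (hp.continuous_space t ht).add (hq.continuous_space t ht)
  continuousAt_time t ht x := (hp.continuousAt_time t ht x).add (hq.continuousAt_time t ht x)

lemma HasOrder.const_mul {j : ℕ} {q : ℝ → ℝ → ℝ} (c : ℝ) (hq : HasOrder ν j q) :
    HasOrder ν j (fun t x => c * q t x) where
  bound a b ha := by
    obtain ⟨D, hD, h'⟩ := hq.bound a b ha
    refine ⟨|c| * D, by positivity, fun t ht x => ?_⟩
    rw [abs_mul, mul_assoc]
    exact mul_le_mul_of_nonneg_left (h' t ht x) (abs_nonneg c)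
  continuous_space t ht := (hq.continuous_space t ht).const_mul c
  continuousAt_time t ht x := (hq.continuousAt_time t ht x).const_mul c

lemma HasOrder.pow {j : ℕ} {q : ℝ → ℝ → ℝ} (hq : HasOrder ν j q) (n : ℕ) :
    HasOrder ν (j * n) (fun t x => q t x ^ n) where
  bound a b ha := by
    obtain ⟨D, hD, h'⟩ := hq.bound a b ha
    refine ⟨D ^ n, by positivity, fun t ht x => ?_⟩
    rw [abs_pow, pow_mul, ← mul_pow]
    exact pow_le_pow_left₀ (abs_nonneg _) (h' t ht x) n
  continuous_space t ht := (hq.continuous_space t ht).pow n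
  continuousAt_time t ht x := (hq.continuousAt_time t ht x).pow n

variable [IsProbabilityMeasure ν]

lemma hasOrder_heatRatio {k : ℕ} (hk : k ≤ 6) : HasOrder ν k (heatRatio ν k) where
  bound a b ha := by
    obtain ⟨C, hC, h⟩ := exists_abs_heatDeriv_le ν ha hk
    refine ⟨C, hC, fun t ht x => ?_⟩
    have h0 := heatDeriv_zero_pos ν (ha.trans_le ht.1) x
    rw [heatRatio, abs_div, abs_of_pos h0, div_le_iff₀ h0]
    exact h t ht.1 x
  continuous_space t ht := (continuous_heatDeriv ν ht k).div (continuous_heatDeriv ν ht 0)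
    fun x => (heatDeriv_zero_pos ν ht x).ne'
  continuousAt_time t ht x := (hasDerivAt_heatDeriv_time ν ht k x).continuousAt.div
    (hasDerivAt_heatDeriv_time ν ht 0 x).continuousAt (heatDeriv_zero_pos ν ht x).ne'

lemma HasOrder.mul {i j : ℕ} {p q : ℝ → ℝ → ℝ} (hp : HasOrder ν i p) (hq : HasOrder ν j q) :
    HasOrder ν (i + j) (fun t x => p t x * q t x) where
  bound a b ha := by
    obtain ⟨C, hC, h⟩ := hp.bound a b ha
    obtain ⟨D, hD, h'⟩ := hq.bound a b ha
    refine ⟨C * D, by positivity, fun t ht x => ?_⟩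
    have := one_le_growth ν (ha.trans_le ht.1) x
    calc |p t x * q t x| = |p t x| * |q t x| := abs_mul _ _
      _ ≤ (C * growth ν t x ^ i) * (D * growth ν t x ^ j) :=
          mul_le_mul (h t ht x) (h' t ht x) (abs_nonneg _) (by positivity)
      _ = _ := by ring
  continuous_space t ht := (hp.continuous_space t ht).mul (hq.continuous_space t ht)
  continuousAt_time t ht x := (hp.continuousAt_time t ht x).mul (hq.continuousAt_time t ht x)

lemma HasOrder.mono {i j : ℕ} {q : ℝ → ℝ → ℝ} (hq : HasOrder ν i q) (hij : i ≤ j) :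
    HasOrder ν j q where
  bound a b ha := by
    obtain ⟨D, hD, h'⟩ := hq.bound a b ha
    refine ⟨D, hD, fun t ht x => (h' t ht x).trans ?_⟩
    exact mul_le_mul_of_nonneg_left
      (pow_le_pow_right₀ (one_le_growth ν (ha.trans_le ht.1) x) hij) hD
  continuous_space := hq.continuous_space
  continuousAt_time := hq.continuousAt_time

/-- Order 6 is the critical one: `f N^6` is exactly the moment density, which `momentDensity_le`
compares with its value at time `b`. The dominating function is thus independent of `t`. -/
lemma HasOrder.exists_bound {q : ℝ → ℝ → ℝ} (hq : HasOrder ν 6 q) {a b : ℝ} (ha : 0 < a) :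
    ∃ C : ℝ, 0 ≤ C ∧ ∀ t ∈ Set.Icc a b, ∀ x,
      ‖heatDeriv ν 0 t x * q t x‖ ≤ C * momentDensity ν b x := by
  obtain ⟨C, hC, h⟩ := hq.bound a b ha
  refine ⟨C * Real.sqrt (b / a), by positivity, fun t ht x => ?_⟩
  have h0 := heatDeriv_zero_pos ν (ha.trans_le ht.1) x
  calc ‖heatDeriv ν 0 t x * q t x‖ = heatDeriv ν 0 t x * |q t x| := by
        rw [norm_mul, Real.norm_of_nonneg h0.le, Real.norm_eq_abs]
    _ ≤ heatDeriv ν 0 t x * (C * growth ν t x ^ 6) := mul_le_mul_of_nonneg_left (h t ht x) h0.le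
    _ = C * momentDensity ν t x := by rw [← growth_pow_six ν (ha.trans_le ht.1) x]; ring
    _ ≤ C * (Real.sqrt (b / a) * momentDensity ν b x) :=
        mul_le_mul_of_nonneg_left (momentDensity_le ν ha ht.1 ht.2 x) hC
    _ = _ := by ring

lemma HasOrder.continuous_heat_mul {j : ℕ} {q : ℝ → ℝ → ℝ} (hq : HasOrder ν j q) {t : ℝ}
    (ht : 0 < t) : Continuous fun x => heatDeriv ν 0 t x * q t x :=
  (continuous_heatDeriv ν ht 0).mul (hq.continuous_space t ht)

lemma HasOrder.integrable {q : ℝ → ℝ → ℝ} (hq : HasOrder ν 6 q) {t : ℝ} (ht : 0 < t) :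
    Integrable fun x => heatDeriv ν 0 t x * q t x := by
  obtain ⟨C, -, hC⟩ := hq.exists_bound (b := t) ht
  exact ((integrable_momentDensity ν ht).const_mul C).mono'
    (hq.continuous_heat_mul ht).aestronglyMeasurable
    (Filter.Eventually.of_forall fun x => hC t ⟨le_rfl, le_rfl⟩ x)

lemma HasOrder.continuousAt_integral {q : ℝ → ℝ → ℝ} (hq : HasOrder ν 6 q) {t : ℝ} (ht : 0 < t) :
    ContinuousAt (fun t => ∫ x, heatDeriv ν 0 t x * q t x) t := by
  obtain ⟨C, -, hC⟩ := hq.exists_bound (b := 2 * t) (half_pos ht)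
  have hs : Set.Icc (t / 2) (2 * t) ∈ nhds t := Icc_mem_nhds (by linarith) (by linarith)
  refine continuousAt_of_dominated (bound := fun x => C * momentDensity ν (2 * t) x) ?_ ?_
    ((integrable_momentDensity ν (by positivity)).const_mul C)
    (Filter.Eventually.of_forall fun x =>
      (hasDerivAt_heatDeriv_time ν ht 0 x).continuousAt.mul (hq.continuousAt_time t ht x))
  · filter_upwards [hs] with s hs
    exact (hq.integrable ((half_pos ht).trans_le hs.1)).1
  · filter_upwards [hs] with s hs
    exact Filter.Eventually.of_forall fun x => hC s hs x

lemma HasOrder.hasDerivAt_integral {q q' : ℝ → ℝ → ℝ} (hq : HasOrder ν 6 q)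
    (hq' : HasOrder ν 6 q')
    (h : ∀ t, 0 < t → ∀ x, HasDerivAt (fun t => heatDeriv ν 0 t x * q t x)
      (heatDeriv ν 0 t x * q' t x) t) {t : ℝ} (ht : 0 < t) :
    HasDerivAt (fun t => ∫ x, heatDeriv ν 0 t x * q t x) (∫ x, heatDeriv ν 0 t x * q' t x) t := by
  obtain ⟨C, -, hC⟩ := hq'.exists_bound (b := 2 * t) (half_pos ht)
  have hs : Set.Icc (t / 2) (2 * t) ∈ nhds t := Icc_mem_nhds (by linarith) (by linarith)
  refine (hasDerivAt_integral_of_dominated_loc_of_deriv_le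
    (F := fun t x => heatDeriv ν 0 t x * q t x) (F' := fun t x => heatDeriv ν 0 t x * q' t x)
    (bound := fun x => C * momentDensity ν (2 * t) x) hs ?_ (hq.integrable ht)
    (hq'.integrable ht).1
    (Filter.Eventually.of_forall fun x s hs => hC s hs x)
    ((integrable_momentDensity ν (by positivity)).const_mul C)
    (Filter.Eventually.of_forall fun x s hs => h s ((half_pos ht).trans_le hs.1) x)).2
  filter_upwards [hs] with s hs
  exact (hq.integrable ((half_pos ht).trans_le hs.1)).1

/-- Integration by parts on the line without boundary terms: integrability of the primitive and of
its derivative suffices. -/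
lemma HasOrder.integral_eq_zero {q q' : ℝ → ℝ → ℝ} (hq : HasOrder ν 6 q)
    (hq' : HasOrder ν 6 q') {t : ℝ} (ht : 0 < t)
    (h : ∀ x, HasDerivAt (fun x => heatDeriv ν 0 t x * q t x) (heatDeriv ν 0 t x * q' t x) x) :
    ∫ x, heatDeriv ν 0 t x * q' t x = 0 :=
  integral_eq_zero_of_hasDerivAt_of_integrable h (hq'.integrable ht) (hq.integrable ht)

lemma hasDerivAt_heatRatio_space (k : ℕ) {t : ℝ} (ht : 0 < t) (x : ℝ) :
    HasDerivAt (heatRatio ν k t)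
      (heatRatio ν (k + 1) t x - heatRatio ν k t x * heatRatio ν 1 t x) x := by
  have h0 := (heatDeriv_zero_pos ν ht x).ne'
  refine ((hasDerivAt_heatDeriv_space ν ht k x).div
    (hasDerivAt_heatDeriv_space ν ht 0 x) h0).congr_deriv ?_
  simp only [heatRatio, zero_add]
  field_simp

lemma hasDerivAt_heatRatio_time (k : ℕ) {t : ℝ} (ht : 0 < t) (x : ℝ) :
    HasDerivAt (fun t => heatRatio ν k t x)
      (1 / 2 * (heatRatio ν (k + 2) t x - heatRatio ν k t x * heatRatio ν 2 t x)) t := by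
  have h0 := (heatDeriv_zero_pos ν ht x).ne'
  refine ((hasDerivAt_heatDeriv_time ν ht k x).div
    (hasDerivAt_heatDeriv_time ν ht 0 x) h0).congr_deriv ?_
  simp only [heatRatio, zero_add]
  field_simp

lemma hasDerivAt_heat_space {t : ℝ} (ht : 0 < t) (x : ℝ) :
    HasDerivAt (heatDeriv ν 0 t) (heatDeriv ν 0 t x * heatRatio ν 1 t x) x := by
  refine (hasDerivAt_heatDeriv_space ν ht 0 x).congr_deriv ?_
  rw [heatRatio, mul_div_cancel₀ _ (heatDeriv_zero_pos ν ht x).ne']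

lemma hasDerivAt_heat_time {t : ℝ} (ht : 0 < t) (x : ℝ) :
    HasDerivAt (fun t => heatDeriv ν 0 t x)
      (heatDeriv ν 0 t x * (1 / 2 * heatRatio ν 2 t x)) t := by
  refine (hasDerivAt_heatDeriv_time ν ht 0 x).congr_deriv ?_
  have := (heatDeriv_zero_pos ν ht x).ne'
  rw [heatRatio]
  field_simp

end

/-! ### Surprisal, a Harnack inequality, and propagation of finite entropy. -/

/-- The heat flow without its normalising factor. -/
def expMoment (ν : Measure ℝ) (t x : ℝ) : ℝ :=
  ∫ y, Real.exp (-(x - y) ^ 2 / (2 * t)) ∂ν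

/-- The negative logarithm of the unnormalised heat flow. -/
def surprisal (ν : Measure ℝ) (t x : ℝ) : ℝ :=
  -Real.log (expMoment ν t x)

section

lemma heatDeriv_zero_eq (ν : Measure ℝ) (t x : ℝ) :
    heatDeriv ν 0 t x = 1 / Real.sqrt (2 * Real.pi * t) * expMoment ν t x := by
  simp only [heatDeriv, gaussDeriv, expMoment, integral_const_mul]

variable (ν : Measure ℝ)

lemma expMoment_eq {t : ℝ} (ht : 0 < t) (x : ℝ) :
    expMoment ν t x = Real.sqrt (2 * Real.pi * t) * heatDeriv ν 0 t x := by
  have : 0 < Real.sqrt (2 * Real.pi * t) := by positivity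
  rw [heatDeriv_zero_eq]
  field_simp

lemma exp_neg_sq_div_le_one {t : ℝ} (ht : 0 < t) (u : ℝ) :
    Real.exp (-u ^ 2 / (2 * t)) ≤ 1 := by
  rw [Real.exp_le_one_iff, neg_div]
  have : 0 ≤ u ^ 2 / (2 * t) := by positivity
  linarith

variable [IsProbabilityMeasure ν]

lemma integrable_exp_sub {t : ℝ} (ht : 0 < t) (x : ℝ) :
    Integrable (fun y => Real.exp (-(x - y) ^ 2 / (2 * t))) ν := by
  refine .of_bound (Continuous.aestronglyMeasurable (by fun_prop)) 1
    (Filter.Eventually.of_forall fun y => ?_)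
  rw [Real.norm_of_nonneg (Real.exp_pos _).le]
  exact exp_neg_sq_div_le_one ht _

lemma expMoment_pos {t : ℝ} (ht : 0 < t) (x : ℝ) : 0 < expMoment ν t x := by
  have := heatDeriv_zero_pos ν ht x
  rw [expMoment_eq ν ht]
  positivity

lemma expMoment_le_one {t : ℝ} (ht : 0 < t) (x : ℝ) : expMoment ν t x ≤ 1 :=
  (integral_mono (integrable_exp_sub ν ht x) (integrable_const 1)
    fun y => exp_neg_sq_div_le_one ht _).trans_eq (by simp)

/-- This is the gain from dropping the prefactor: the unnormalised flow is at most 1 and increases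
in time, so the surprisal is nonnegative and decreases in time. -/
lemma expMoment_mono {s t : ℝ} (hs : 0 < s) (hst : s ≤ t) (x : ℝ) :
    expMoment ν s x ≤ expMoment ν t x := by
  refine integral_mono (integrable_exp_sub ν hs x)
    (integrable_exp_sub ν (hs.trans_le hst) x) fun y => ?_
  simp only
  rw [neg_div, neg_div]
  gcongr

lemma surprisal_nonneg {t : ℝ} (ht : 0 < t) (x : ℝ) : 0 ≤ surprisal ν t x :=
  neg_nonneg.2 (Real.log_nonpos (expMoment_pos ν ht x).le (expMoment_le_one ν ht x))

lemma surprisal_anti {s t : ℝ} (hs : 0 < s) (hst : s ≤ t) (x : ℝ) :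
    surprisal ν t x ≤ surprisal ν s x :=
  neg_le_neg (Real.log_le_log (expMoment_pos ν hs x) (expMoment_mono ν hs hst x))

lemma continuous_surprisal {t : ℝ} (ht : 0 < t) : Continuous (surprisal ν t) := by
  have h : Continuous (expMoment ν t) := by
    simp only [funext (expMoment_eq ν ht)]
    exact (continuous_heatDeriv ν ht 0).const_mul _
  exact (h.log fun x => (expMoment_pos ν ht x).ne').neg

/-- By Jensen, `c²` is at most the mean of the squared kernel. Squaring the kernel doubles its
exponent, and the identity with `(x - y - w)² ≥ 0` then pays for the translation by `w`. -/
lemma expMoment_sq_le {t : ℝ} (ht : 0 < t) (x w : ℝ) :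
    expMoment ν t x ^ 2 ≤ Real.exp (w ^ 2 / t) * expMoment ν t (x + w) := by
  set c := expMoment ν t x with hc
  have hle : ∫ y, (2 * c * Real.exp (-(x - y) ^ 2 / (2 * t)) - c ^ 2) ∂ν ≤
      ∫ y, Real.exp (w ^ 2 / t) * Real.exp (-(x + w - y) ^ 2 / (2 * t)) ∂ν := by
    refine integral_mono (((integrable_exp_sub ν ht x).const_mul _).sub (integrable_const _))
      ((integrable_exp_sub ν ht (x + w)).const_mul _) fun y => ?_
    simp only
    set h := Real.exp (-(x - y) ^ 2 / (2 * t)) with hh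
    have h1 : h ^ 2 ≤ Real.exp (w ^ 2 / t) * Real.exp (-(x + w - y) ^ 2 / (2 * t)) := by
      rw [hh, ← Real.exp_add, sq, ← Real.exp_add]
      refine Real.exp_le_exp.2 ?_
      have : w ^ 2 / t + -(x + w - y) ^ 2 / (2 * t)
          - (-(x - y) ^ 2 / (2 * t) + -(x - y) ^ 2 / (2 * t)) = (x - y - w) ^ 2 / (2 * t) := by
        field_simp
        ring
      have h3 : 0 ≤ (x - y - w) ^ 2 / (2 * t) := by positivity
      linarith
    -- Jensen in pointwise form: `2ch - c² ≤ h²`, whose left side has mean `c²`.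
    nlinarith [sq_nonneg (h - c)]
  rw [integral_sub ((integrable_exp_sub ν ht x).const_mul _) (integrable_const _),
    integral_const_mul, integral_const_mul] at hle
  change 2 * c * c - _ ≤ _ * expMoment ν t (x + w) at hle
  simp only [integral_const, probReal_univ, one_smul] at hle
  linarith

/-- The Harnack inequality, as the logarithm of `expMoment_sq_le`. A translation at most doubles the
surprisal, up to a quadratic error that Gaussian weights can integrate. -/
lemma surprisal_add_le {t : ℝ} (ht : 0 < t) (x w : ℝ) :
    surprisal ν t (x + w) ≤ 2 * surprisal ν t x + w ^ 2 / t := by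
  have h := Real.log_le_log (pow_pos (expMoment_pos ν ht x) 2) (expMoment_sq_le ν ht x w)
  rw [Real.log_pow, Real.log_mul (Real.exp_pos _).ne' (expMoment_pos ν ht _).ne',
    Real.log_exp] at h
  simp only [surprisal]
  push_cast at h
  linarith

lemma integral_gaussDeriv_zero {t : ℝ} (ht : 0 < t) : ∫ u, gaussDeriv t u 0 = 1 := by
  have h := integral_gaussianPDFReal_eq_one 0 (v := t.toNNReal) (by simpa using ht)
  simpa [gaussianPDFReal, gaussDeriv, Real.coe_toNNReal t ht.le] using h

/-- Tonelli and the substitution `x = y + u` reduce integrals against the flow or its moment density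
to kernel integrals centred at a fixed `y`. -/
lemma lintegral_average_mul {w g : ℝ → ℝ} (hw : Continuous w) (hw0 : ∀ u, 0 ≤ w u)
    (hg : Continuous g) (hg0 : ∀ u, 0 ≤ g u)
    (hi : ∀ x, Integrable (fun y => w (x - y)) ν) :
    ∫⁻ x, ENNReal.ofReal ((∫ y, w (x - y) ∂ν) * g x) =
      ∫⁻ y, (∫⁻ u, ENNReal.ofReal (w u) * ENNReal.ofReal (g (y + u))) ∂ν := by
  calc ∫⁻ x, ENNReal.ofReal ((∫ y, w (x - y) ∂ν) * g x)
      = ∫⁻ x, ∫⁻ y, ENNReal.ofReal (w (x - y) * g x) ∂ν := by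
        refine lintegral_congr fun x => ?_
        rw [← integral_mul_const, ofReal_integral_eq_lintegral_ofReal ((hi x).mul_const _)
          (Filter.Eventually.of_forall fun y => mul_nonneg (hw0 _) (hg0 _))]
    _ = ∫⁻ y, (∫⁻ x, ENNReal.ofReal (w (x - y) * g x)) ∂ν :=
        lintegral_lintegral_swap (f := fun x y => ENNReal.ofReal (w (x - y) * g x))
          (Continuous.measurable (f := fun p : ℝ × ℝ => w (p.1 - p.2) * g p.1)
            (by fun_prop)).ennreal_ofReal.aemeasurable
    _ = _ := by
        refine lintegral_congr fun y => ?_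
        rw [← lintegral_add_right_eq_self _ y]
        refine lintegral_congr fun u => ?_
        rw [add_sub_cancel_right, ENNReal.ofReal_mul (hw0 u), add_comm]

/-- When `b > s`, the wider kernel is not bounded by a multiple of the narrower one, so kernels
cannot be compared pointwise. Instead the surprisal at `y + u` is compared with that at `y + v` by
Harnack, averaged over `v` against the Gaussian of variance `s`, then integrated over `u`. It
matters that `A` and `B` do not depend on `y`. -/
lemma lintegral_weight_surprisal_le {s b : ℝ} (hs : 0 < s) (hb : 0 < b) :
    ∃ A B : ENNReal, A ≠ ⊤ ∧ B ≠ ⊤ ∧ ∀ y,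
      ∫⁻ u, ENNReal.ofReal ((1 + |u|) ^ 6 * gaussDeriv b u 0) *
        ENNReal.ofReal (surprisal ν s (y + u)) ≤
      A * (∫⁻ u, ENNReal.ofReal (gaussDeriv s u 0) * ENNReal.ofReal (surprisal ν s (y + u))) + B := by
  set w : ℝ → ENNReal := fun u => ENNReal.ofReal ((1 + |u|) ^ 6 * gaussDeriv b u 0) with hw
  set G : ℝ → ENNReal := fun u => ENNReal.ofReal (gaussDeriv s u 0) with hG
  set p : ℝ → ENNReal := fun u => ENNReal.ofReal ((1 + |u|) ^ 2) with hp
  have mw : Measurable w := (continuous_weight_mul_gaussDeriv b 6).measurable.ennreal_ofReal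
  have mG : Measurable G := (continuous_gaussDeriv s 0).measurable.ennreal_ofReal
  have mp : Measurable p := Measurable.ennreal_ofReal (Continuous.measurable (by fun_prop))
  have mg := (continuous_surprisal ν hs).measurable.ennreal_ofReal
  have iG : ∫⁻ u, G u = 1 := by
    rw [← ofReal_integral_eq_lintegral_ofReal
      (by simpa using integrable_weight_mul_gaussDeriv hs 0)
      (Filter.Eventually.of_forall fun u => (gaussDeriv_zero_pos hs u).le),
      integral_gaussDeriv_zero hs, ENNReal.ofReal_one]
  have iw : ∫⁻ u, w u ≠ ⊤ := (integrable_weight_mul_gaussDeriv hb 6).lintegral_lt_top.ne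
  have iwp : ∫⁻ u, w u * p u ≠ ⊤ := by
    -- The exponent 8 is the moment weight 6 plus 2 from the Harnack error.
    have : ∀ u, w u * p u = ENNReal.ofReal ((1 + |u|) ^ 8 * gaussDeriv b u 0) := fun u => by
      rw [hw, hp, ← ENNReal.ofReal_mul (mul_nonneg (by positivity) (gaussDeriv_zero_pos hb u).le)]
      congr 1
      ring
    simp only [this]
    exact (integrable_weight_mul_gaussDeriv hb 8).lintegral_lt_top.ne
  have iGp : ∫⁻ u, G u * p u ≠ ⊤ := by
    have : ∀ u, G u * p u = ENNReal.ofReal ((1 + |u|) ^ 2 * gaussDeriv s u 0) := fun u => by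
      rw [hG, hp, ← ENNReal.ofReal_mul (gaussDeriv_zero_pos hs u).le, mul_comm]
    simp only [this]
    exact (integrable_weight_mul_gaussDeriv hs 2).lintegral_lt_top.ne
  set c := ENNReal.ofReal (2 / s) with hc
  have harnack : ∀ y u v, ENNReal.ofReal (surprisal ν s (y + u)) ≤
      2 * ENNReal.ofReal (surprisal ν s (y + v)) + c * p u * p v := fun y u v => by
    have h := surprisal_add_le ν hs (y + v) (u - v)
    rw [show y + v + (u - v) = y + u by ring] at h
    have h2 : (u - v) ^ 2 / s ≤ 2 / s * (1 + |u|) ^ 2 * (1 + |v|) ^ 2 := by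
      have hu := abs_nonneg u
      have hv := abs_nonneg v
      have h3 : |u - v| ≤ (1 + |u|) * (1 + |v|) := by
        have := abs_sub u v
        nlinarith
      have h4 : (u - v) ^ 2 ≤ ((1 + |u|) * (1 + |v|)) ^ 2 := by
        rw [← sq_abs]
        exact pow_le_pow_left₀ (abs_nonneg _) h3 2
      rw [div_mul_eq_mul_div, div_mul_eq_mul_div]
      gcongr
      nlinarith [sq_nonneg ((1 + |u|) * (1 + |v|))]
    calc ENNReal.ofReal (surprisal ν s (y + u))
        ≤ ENNReal.ofReal (2 * surprisal ν s (y + v)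
            + 2 / s * (1 + |u|) ^ 2 * (1 + |v|) ^ 2) := ENNReal.ofReal_le_ofReal (by linarith)
      _ = _ := by
        rw [ENNReal.ofReal_add (mul_nonneg zero_le_two (surprisal_nonneg ν hs _)) (by positivity),
          ENNReal.ofReal_mul zero_le_two, ENNReal.ofReal_mul (by positivity),
          ENNReal.ofReal_mul (by positivity), ENNReal.ofReal_ofNat]
  refine ⟨2 * ∫⁻ u, w u, c * (∫⁻ u, w u * p u) * ∫⁻ u, G u * p u,
    ENNReal.mul_ne_top (by simp) iw,
    ENNReal.mul_ne_top (ENNReal.mul_ne_top ENNReal.ofReal_ne_top iwp) iGp, fun y => ?_⟩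
  have mgy : Measurable fun u => ENNReal.ofReal (surprisal ν s (y + u)) :=
    mg.comp (measurable_const_add y)
  have mGg : Measurable fun v => G v * ENNReal.ofReal (surprisal ν s (y + v)) := mG.mul mgy
  have mGp : Measurable fun v => G v * p v := mG.mul mp
  have mwp : Measurable fun u => w u * p u := mw.mul mp
  -- The Gaussian has mass 1, so the left side, constant in `v`, equals its average over `v`.
  have step : ∀ u, ENNReal.ofReal (surprisal ν s (y + u)) ≤
      2 * (∫⁻ v, G v * ENNReal.ofReal (surprisal ν s (y + v)))
        + c * p u * ∫⁻ v, G v * p v := fun u => by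
    calc ENNReal.ofReal (surprisal ν s (y + u))
        = ∫⁻ v, G v * ENNReal.ofReal (surprisal ν s (y + u)) := by
          rw [lintegral_mul_const _ mG, iG, one_mul]
      _ ≤ ∫⁻ v, (2 * (G v * ENNReal.ofReal (surprisal ν s (y + v)))
            + c * p u * (G v * p v)) := by
          refine lintegral_mono fun v => (mul_le_mul_right (harnack y u v) (G v)).trans_eq ?_
          ring
      _ = _ := by
          rw [lintegral_add_left (mGg.const_mul _), lintegral_const_mul _ mGg,
            lintegral_const_mul _ mGp]
  set E := ∫⁻ v, G v * ENNReal.ofReal (surprisal ν s (y + v))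
  set K := ∫⁻ v, G v * p v
  calc ∫⁻ u, w u * ENNReal.ofReal (surprisal ν s (y + u))
      ≤ ∫⁻ u, (w u * (2 * E) + w u * p u * (c * K)) := by
        refine lintegral_mono fun u => (mul_le_mul_right (step u) (w u)).trans_eq ?_
        ring
    _ = _ := by
        rw [lintegral_add_left (mw.mul_const _), lintegral_mul_const _ mw,
          lintegral_mul_const _ mwp]
        ring

lemma integrable_momentDensity_mul_surprisal {s b : ℝ} (hs : 0 < s) (hb : 0 < b)
    (h : Integrable fun x => heatDeriv ν 0 s x * surprisal ν s x) :
    Integrable fun x => momentDensity ν b x * surprisal ν s x := by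
  have hg := continuous_surprisal ν hs
  refine ⟨(integrable_momentDensity ν hb).1.mul hg.aestronglyMeasurable, ?_⟩
  rw [hasFiniteIntegral_iff_ofReal (Filter.Eventually.of_forall fun x =>
    mul_nonneg (momentDensity_pos ν hb x).le (surprisal_nonneg ν hs x))]
  have h1 := lintegral_average_mul ν (continuous_weight_mul_gaussDeriv b 6)
    (fun u => mul_nonneg (by positivity) (gaussDeriv_zero_pos hb u).le) hg
    (surprisal_nonneg ν hs) (integrable_weight_sub ν hb 6)
  have h2 := lintegral_average_mul ν (continuous_gaussDeriv s 0)
    (fun u => (gaussDeriv_zero_pos hs u).le) hg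
    (surprisal_nonneg ν hs) (integrable_gaussDeriv_sub ν hs 0)
  have hfin : ∫⁻ x, ENNReal.ofReal (heatDeriv ν 0 s x * surprisal ν s x) < ⊤ :=
    h.lintegral_lt_top
  simp only [heatDeriv] at hfin
  rw [h2] at hfin
  simp only [momentDensity]
  rw [h1]
  obtain ⟨A, B, hA, hB, hAB⟩ := lintegral_weight_surprisal_le ν hs hb
  refine (lintegral_mono hAB).trans_lt ?_
  rw [lintegral_add_right _ measurable_const, lintegral_const_mul' _ _ hA]
  simp only [lintegral_const, measure_univ, mul_one]
  exact ENNReal.add_lt_top.2 ⟨ENNReal.mul_lt_top hA.lt_top hfin, hB.lt_top⟩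

/-- The function `u (1 - log u)` has derivative `-log u ≥ 0` on `(0, 1]`. The added `u` is needed
because `-u log u` alone is not monotone there. -/
lemma mul_one_sub_log_mono {u v : ℝ} (hu : 0 < u) (huv : u ≤ v) (hv : v ≤ 1) :
    u * (1 - Real.log u) ≤ v * (1 - Real.log v) := by
  have hv0 := hu.trans_le huv
  have h1 := Real.log_le_sub_one_of_pos (div_pos hv0 hu)
  rw [Real.log_div hv0.ne' hu.ne'] at h1
  have h2 : u * (Real.log v - Real.log u) ≤ v - u := by
    calc u * (Real.log v - Real.log u) ≤ u * (v / u - 1) := mul_le_mul_of_nonneg_left h1 hu.le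
      _ = v - u := by field_simp
  have h3 := Real.log_nonpos hv0.le hv
  nlinarith

/-- Finiteness of the entropy propagates to all times. -/
lemma integrable_heat_mul_surprisal {s : ℝ} (hs : 0 < s)
    (h : Integrable fun x => heatDeriv ν 0 s x * surprisal ν s x) {t : ℝ} (ht : 0 < t) :
    Integrable fun x => heatDeriv ν 0 t x * surprisal ν t x := by
  have hm : AEStronglyMeasurable fun x => heatDeriv ν 0 t x * surprisal ν t x :=
    ((continuous_heatDeriv ν ht 0).mul (continuous_surprisal ν ht)).aestronglyMeasurable
  have hn : ∀ x, ‖heatDeriv ν 0 t x * surprisal ν t x‖ = heatDeriv ν 0 t x * surprisal ν t x :=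
    fun x => Real.norm_of_nonneg
      (mul_nonneg (heatDeriv_zero_pos ν ht x).le (surprisal_nonneg ν ht x))
  rcases le_total s t with hst | hst
  -- Forward in time the surprisal decreases, and the kernel at time `t` is handled by the Harnack
  -- transfer. Backward in time, monotonicity of `u (1 - log u)` suffices.
  · refine (integrable_momentDensity_mul_surprisal ν hs ht h).mono' hm
      (Filter.Eventually.of_forall fun x => ?_)
    rw [hn]
    exact mul_le_mul (heatDeriv_zero_le_momentDensity ν ht x) (surprisal_anti ν hs hst x)
      (surprisal_nonneg ν ht x) (momentDensity_pos ν ht x).le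
  · refine (((integrable_heatDeriv_zero ν hs).add h).const_mul
      (1 / Real.sqrt (2 * Real.pi * t) * Real.sqrt (2 * Real.pi * s))).mono' hm
      (Filter.Eventually.of_forall fun x => ?_)
    rw [hn]
    have h1 := mul_one_sub_log_mono (expMoment_pos ν ht x) (expMoment_mono ν ht hst x)
      (expMoment_le_one ν hs x)
    have h0 := expMoment_pos ν ht x
    calc heatDeriv ν 0 t x * surprisal ν t x
        = 1 / Real.sqrt (2 * Real.pi * t) * (expMoment ν t x * surprisal ν t x) := by
          rw [heatDeriv_zero_eq]; ring
      _ ≤ 1 / Real.sqrt (2 * Real.pi * t) * (expMoment ν s x * (1 + surprisal ν s x)) := by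
          refine mul_le_mul_of_nonneg_left ?_ (by positivity)
          simp only [surprisal]
          linarith
      _ = _ := by
          rw [expMoment_eq ν hs]
          simp only [Pi.add_apply]
          ring

lemma log_heatDeriv_zero {t : ℝ} (ht : 0 < t) (x : ℝ) :
    Real.log (heatDeriv ν 0 t x) = -Real.log (Real.sqrt (2 * Real.pi * t)) - surprisal ν t x := by
  rw [heatDeriv_zero_eq, Real.log_mul (by positivity) (expMoment_pos ν ht x).ne', one_div,
    Real.log_inv, surprisal]
  ring

lemma exists_abs_log_heat_le {a b : ℝ} (ha : 0 < a) :
    ∃ c : ℝ, 0 ≤ c ∧ ∀ t ∈ Set.Icc a b, ∀ x,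
      |Real.log (heatDeriv ν 0 t x)| ≤ c + surprisal ν a x := by
  refine ⟨|Real.log (Real.sqrt (2 * Real.pi * a))| + |Real.log (Real.sqrt (2 * Real.pi * b))|,
    by positivity, fun t ht x => ?_⟩
  have ht0 := ha.trans_le ht.1
  have h1 : Real.log (Real.sqrt (2 * Real.pi * a)) ≤ Real.log (Real.sqrt (2 * Real.pi * t)) :=
    Real.log_le_log (by positivity) (Real.sqrt_le_sqrt (by gcongr; exact ht.1))
  have h2 : Real.log (Real.sqrt (2 * Real.pi * t)) ≤ Real.log (Real.sqrt (2 * Real.pi * b)) :=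
    Real.log_le_log (by positivity) (Real.sqrt_le_sqrt (by gcongr; exact ht.2))
  have h3 := surprisal_nonneg ν ht0 x
  have h4 := surprisal_anti ν ha ht.1 x
  have := neg_abs_le (Real.log (Real.sqrt (2 * Real.pi * a)))
  have := le_abs_self (Real.log (Real.sqrt (2 * Real.pi * b)))
  have := abs_nonneg (Real.log (Real.sqrt (2 * Real.pi * a)))
  have := abs_nonneg (Real.log (Real.sqrt (2 * Real.pi * b)))
  rw [log_heatDeriv_zero ν ht0, abs_le]
  constructor <;> linarith

end

/-! ### Assembling iterated derivatives on the half-line from successive `HasDerivAt` facts. -/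

section calculus

lemma contDiffOn_Ioi_succ {n : ℕ} {f f' : ℝ → ℝ} (h : ∀ t, 0 < t → HasDerivAt f (f' t) t)
    (hf' : ContDiffOn ℝ n f' (Set.Ioi 0)) : ContDiffOn ℝ ((n + 1 : ℕ) : WithTop ℕ∞) f (Set.Ioi 0) := by
  push_cast
  rw [contDiffOn_succ_iff_deriv_of_isOpen isOpen_Ioi]
  refine ⟨fun t ht => (h t ht).differentiableAt.differentiableWithinAt, by simp, ?_⟩
  exact hf'.congr fun t ht => (h t ht).deriv

lemma deriv_eventuallyEq_of_hasDerivAt {f g f' : ℝ → ℝ} (h : ∀ t, 0 < t → HasDerivAt f (f' t) t)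
    {t : ℝ} (ht : 0 < t) (hg : g =ᶠ[nhds t] f) : deriv g =ᶠ[nhds t] f' := by
  refine hg.deriv.trans ?_
  filter_upwards [Ioi_mem_nhds ht] with s hs
  exact (h s hs).deriv

lemma contDiffOn_three_of_hasDerivAt {f f₁ f₂ f₃ : ℝ → ℝ}
    (h₀ : ∀ t, 0 < t → HasDerivAt f (f₁ t) t) (h₁ : ∀ t, 0 < t → HasDerivAt f₁ (f₂ t) t)
    (h₂ : ∀ t, 0 < t → HasDerivAt f₂ (f₃ t) t) (h₃ : ∀ t, 0 < t → ContinuousAt f₃ t) :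
    ContDiffOn ℝ 3 f (Set.Ioi 0) := by
  have : ContDiffOn ℝ (0 : ℕ) f₃ (Set.Ioi 0) :=
    contDiffOn_zero.2 fun t ht => (h₃ t ht).continuousWithinAt
  exact contDiffOn_Ioi_succ h₀ (contDiffOn_Ioi_succ h₁ (contDiffOn_Ioi_succ h₂ this))

lemma iteratedDeriv_three_of_hasDerivAt {f f₁ f₂ f₃ : ℝ → ℝ}
    (h₀ : ∀ t, 0 < t → HasDerivAt f (f₁ t) t) (h₁ : ∀ t, 0 < t → HasDerivAt f₁ (f₂ t) t)
    (h₂ : ∀ t, 0 < t → HasDerivAt f₂ (f₃ t) t) {t : ℝ} (ht : 0 < t) :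
    iteratedDeriv 3 f t = f₃ t := by
  simp only [iteratedDeriv_succ, iteratedDeriv_zero]
  exact (deriv_eventuallyEq_of_hasDerivAt h₂ ht (deriv_eventuallyEq_of_hasDerivAt h₁ ht
    (deriv_eventuallyEq_of_hasDerivAt h₀ ht .rfl))).self_of_nhds

end calculus

/-! ### Derivatives of the Fisher information, integrations by parts, positivity, de Bruijn's
identity. -/

section

variable {ν : Measure ℝ}

lemma HasOrder.sub {j : ℕ} {p q : ℝ → ℝ → ℝ} (hp : HasOrder ν j p) (hq : HasOrder ν j q) :
    HasOrder ν j (fun t x => p t x - q t x) := by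
  simpa [sub_eq_add_neg] using hp.add (hq.const_mul (-1))

variable [IsProbabilityMeasure ν]

lemma hasOrder_two : HasOrder ν 6 (heatRatio ν 2) :=
  (hasOrder_heatRatio (by norm_num)).mono (by norm_num)

/-- The Fisher information integrand divided by the density. -/
def fisherForm (ν : Measure ℝ) (t x : ℝ) : ℝ := heatRatio ν 1 t x ^ 2

/-- The time derivative of the Fisher information integrand, divided by the density. -/
def fisherForm₁ (ν : Measure ℝ) (t x : ℝ) : ℝ :=
  heatRatio ν 1 t x * heatRatio ν 3 t x - 1 / 2 * (heatRatio ν 1 t x ^ 2 * heatRatio ν 2 t x)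

/-- The second time derivative of the Fisher information integrand, divided by the density. -/
def fisherForm₂ (ν : Measure ℝ) (t x : ℝ) : ℝ :=
  1 / 2 * heatRatio ν 3 t x ^ 2 + 1 / 2 * (heatRatio ν 1 t x * heatRatio ν 5 t x)
    - heatRatio ν 1 t x * heatRatio ν 2 t x * heatRatio ν 3 t x
    + 1 / 2 * (heatRatio ν 1 t x ^ 2 * heatRatio ν 2 t x ^ 2)
    - 1 / 4 * (heatRatio ν 1 t x ^ 2 * heatRatio ν 4 t x)

/-- A quadratic form in the three monomials of total order three, evaluated on the ratios. -/
def ratioForm (ν : Measure ℝ) (Q : ℝ → ℝ → ℝ → ℝ) (t x : ℝ) : ℝ :=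
  Q (heatRatio ν 3 t x) (heatRatio ν 1 t x * heatRatio ν 2 t x) (heatRatio ν 1 t x ^ 3)

lemma hasOrder_fisherForm : HasOrder ν 6 (fisherForm ν) :=
  ((hasOrder_heatRatio (k := 1) (by norm_num)).pow 2).mono (by norm_num)

lemma hasOrder_fisherForm₁ : HasOrder ν 6 (fisherForm₁ ν) := by
  have r1 := hasOrder_heatRatio (ν := ν) (k := 1) (by norm_num)
  have r2 := hasOrder_heatRatio (ν := ν) (k := 2) (by norm_num)
  have r3 := hasOrder_heatRatio (ν := ν) (k := 3) (by norm_num)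
  exact ((r1.mul r3).mono (by norm_num)).sub
    ((((r1.pow 2).mul r2).mono (by norm_num)).const_mul _)

lemma hasOrder_fisherForm₂ : HasOrder ν 6 (fisherForm₂ ν) := by
  have r1 := hasOrder_heatRatio (ν := ν) (k := 1) (by norm_num)
  have r2 := hasOrder_heatRatio (ν := ν) (k := 2) (by norm_num)
  have r3 := hasOrder_heatRatio (ν := ν) (k := 3) (by norm_num)
  have r4 := hasOrder_heatRatio (ν := ν) (k := 4) (by norm_num)
  have r5 := hasOrder_heatRatio (ν := ν) (k := 5) (by norm_num)
  exact (((((r3.pow 2).const_mul _).add ((r1.mul r5).const_mul _)).sub ((r1.mul r2).mul r3)).add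
    (((r1.pow 2).mul (r2.pow 2)).const_mul _)).sub (((r1.pow 2).mul r4).const_mul _)

lemma hasOrder_ratioForm_reducedForm : HasOrder ν 6 (ratioForm ν reducedForm) := by
  have r1 := hasOrder_heatRatio (ν := ν) (k := 1) (by norm_num)
  have r2 := hasOrder_heatRatio (ν := ν) (k := 2) (by norm_num)
  have r3 := hasOrder_heatRatio (ν := ν) (k := 3) (by norm_num)
  exact ((((r3.pow 2).const_mul _).sub (r3.mul (r1.mul r2))).sub
    (((r1.mul r2).pow 2).const_mul _)).add (((r1.pow 3).pow 2).const_mul _)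

lemma hasOrder_ratioForm_constraintOne : HasOrder ν 6 (ratioForm ν constraintOne) := by
  have r1 := hasOrder_heatRatio (ν := ν) (k := 1) (by norm_num)
  have r2 := hasOrder_heatRatio (ν := ν) (k := 2) (by norm_num)
  exact (((r1.mul r2).const_mul _).mul (r1.pow 3)).sub (((r1.pow 3).pow 2).const_mul _)

lemma hasOrder_ratioForm_constraintTwo : HasOrder ν 6 (ratioForm ν constraintTwo) := by
  have r1 := hasOrder_heatRatio (ν := ν) (k := 1) (by norm_num)
  have r2 := hasOrder_heatRatio (ν := ν) (k := 2) (by norm_num)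
  have r3 := hasOrder_heatRatio (ν := ν) (k := 3) (by norm_num)
  exact ((r3.mul (r1.pow 3)).add (((r1.mul r2).pow 2).const_mul _)).sub
    (((r1.pow 3).pow 2).const_mul _)

lemma hasDerivAt_integral_fisherForm {t : ℝ} (ht : 0 < t) :
    HasDerivAt (fun t => ∫ x, heatDeriv ν 0 t x * fisherForm ν t x)
      (∫ x, heatDeriv ν 0 t x * fisherForm₁ ν t x) t := by
  refine hasOrder_fisherForm.hasDerivAt_integral hasOrder_fisherForm₁ (fun t ht x => ?_) ht
  refine ((hasDerivAt_heat_time ht x).mul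
    ((hasDerivAt_heatRatio_time 1 ht x).pow 2)).congr_deriv ?_
  simp only [fisherForm₁, Pi.pow_apply]
  ring

lemma hasDerivAt_integral_fisherForm₁ {t : ℝ} (ht : 0 < t) :
    HasDerivAt (fun t => ∫ x, heatDeriv ν 0 t x * fisherForm₁ ν t x)
      (∫ x, heatDeriv ν 0 t x * fisherForm₂ ν t x) t := by
  refine hasOrder_fisherForm₁.hasDerivAt_integral hasOrder_fisherForm₂ (fun t ht x => ?_) ht
  have d1 := hasDerivAt_heatRatio_time (ν := ν) 1 ht x
  have d2 := hasDerivAt_heatRatio_time (ν := ν) 2 ht x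
  have d3 := hasDerivAt_heatRatio_time (ν := ν) 3 ht x
  refine ((hasDerivAt_heat_time ht x).mul ((d1.mul d3).sub
    (((d1.pow 2).mul d2).const_mul (1 / 2)))).congr_deriv ?_
  simp only [fisherForm₂, Pi.pow_apply, Pi.mul_apply, Pi.sub_apply]
  ring

/-- The integrand is the exact derivative of `f r_1^5`. -/
lemma integral_constraintOne {t : ℝ} (ht : 0 < t) :
    ∫ x, heatDeriv ν 0 t x * ratioForm ν constraintOne t x = 0 := by
  have r1 := hasOrder_heatRatio (ν := ν) (k := 1) (by norm_num)
  refine ((r1.pow 5).mono (by norm_num)).integral_eq_zero hasOrder_ratioForm_constraintOne ht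
    fun x => ?_
  refine ((hasDerivAt_heat_space ht x).mul
    ((hasDerivAt_heatRatio_space 1 ht x).pow 5)).congr_deriv ?_
  simp only [ratioForm, constraintOne, Pi.pow_apply]
  ring

lemma integral_constraintTwo {t : ℝ} (ht : 0 < t) :
    ∫ x, heatDeriv ν 0 t x * ratioForm ν constraintTwo t x = 0 := by
  have r1 := hasOrder_heatRatio (ν := ν) (k := 1) (by norm_num)
  have r2 := hasOrder_heatRatio (ν := ν) (k := 2) (by norm_num)
  -- The primitive is `f (r_1³ r_2 + (3/5) r_1^5)`; the coefficient `3/5` cancels the `r_1^4 r_2`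
  -- term, that is `m₂m₃`.
  refine HasOrder.integral_eq_zero ((((r1.pow 3).mul r2).add
    ((r1.pow 5).const_mul (3 / 5))).mono (by norm_num)) hasOrder_ratioForm_constraintTwo ht
    fun x => ?_
  have d1 := hasDerivAt_heatRatio_space (ν := ν) 1 ht x
  have d2 := hasDerivAt_heatRatio_space (ν := ν) 2 ht x
  refine ((hasDerivAt_heat_space ht x).mul
    (((d1.pow 3).mul d2).add ((d1.pow 5).const_mul (3 / 5)))).congr_deriv ?_
  simp only [ratioForm, constraintTwo, Pi.pow_apply, Pi.mul_apply, Pi.add_apply]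
  ring

lemma integral_fisherForm₂_eq_reducedForm {t : ℝ} (ht : 0 < t) :
    ∫ x, heatDeriv ν 0 t x * (1 / 2 * fisherForm₂ ν t x) =
      ∫ x, heatDeriv ν 0 t x * ratioForm ν reducedForm t x := by
  have r1 := hasOrder_heatRatio (ν := ν) (k := 1) (by norm_num)
  have r2 := hasOrder_heatRatio (ν := ν) (k := 2) (by norm_num)
  have r3 := hasOrder_heatRatio (ν := ν) (k := 3) (by norm_num)
  have r4 := hasOrder_heatRatio (ν := ν) (k := 4) (by norm_num)
  have hF := (hasOrder_fisherForm₂ (ν := ν)).const_mul (1 / 2)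
  have hR := hasOrder_ratioForm_reducedForm (ν := ν)
  have key : ∫ x, heatDeriv ν 0 t x *
      (1 / 2 * fisherForm₂ ν t x - ratioForm ν reducedForm t x) = 0 := by
    -- In the primitive, `r_1 r_4 / 4` removes `r_1 r_5`, `-r_2 r_3 / 4` cancels the `r_2 r_4` this
    -- creates, and `r_1² r_3 / 8` settles `r_1² r_4`. The last two terms are a quarter of the
    -- primitive behind `constraintTwo` and remove `m₁m₃`.
    refine HasOrder.integral_eq_zero (((((((r1.mul r4).const_mul (1 / 4)).sub
      ((r2.mul r3).const_mul (1 / 4))).add (((r1.pow 2).mul r3).const_mul (1 / 8))).add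
      (((r1.pow 3).mul r2).const_mul (1 / 4))).add ((r1.pow 5).const_mul (3 / 20))).mono
      (by norm_num)) (hF.sub hR) ht fun x => ?_
    have d1 := hasDerivAt_heatRatio_space (ν := ν) 1 ht x
    have d2 := hasDerivAt_heatRatio_space (ν := ν) 2 ht x
    have d3 := hasDerivAt_heatRatio_space (ν := ν) 3 ht x
    have d4 := hasDerivAt_heatRatio_space (ν := ν) 4 ht x
    refine ((hasDerivAt_heat_space ht x).mul ((((((d1.mul d4).const_mul (1 / 4)).sub
      ((d2.mul d3).const_mul (1 / 4))).add (((d1.pow 2).mul d3).const_mul (1 / 8))).add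
      (((d1.pow 3).mul d2).const_mul (1 / 4))).add
      ((d1.pow 5).const_mul (3 / 20)))).congr_deriv ?_
    simp only [fisherForm₂, ratioForm, reducedForm, Pi.pow_apply, Pi.mul_apply, Pi.add_apply,
      Pi.sub_apply]
    ring
  simp only [mul_sub] at key
  rw [integral_sub (hF.integrable ht) (hR.integrable ht)] at key
  exact sub_eq_zero.1 key

/-- A sum of squares: the reduced form is nonnegative modulo the two constraints. -/
lemma reducedForm_eq (m₁ m₂ m₃ : ℝ) :
    reducedForm m₁ m₂ m₃ =
      213 / 1444 * constraintOne m₁ m₂ m₃ + (-407 / 1009) * constraintTwo m₁ m₂ m₃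
        + 1 / 2036162 * (1009 * m₁ + (-1009) * m₂ + 407 * m₃) ^ 2
        + 1 / 1784109085952 * (612256 * m₂ + (-486877) * m₃) ^ 2
        + 69485907702371 / 9000830338627840 * m₃ ^ 2 := by
  simp only [reducedForm, constraintOne, constraintTwo]
  ring

lemma integral_reducedForm_nonneg {t : ℝ} (ht : 0 < t) :
    0 ≤ ∫ x, heatDeriv ν 0 t x * ratioForm ν reducedForm t x := by
  have h1 := (hasOrder_ratioForm_constraintOne (ν := ν)).integrable ht
  have h2 := (hasOrder_ratioForm_constraintTwo (ν := ν)).integrable ht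
  -- The three squares have positive coefficients and `f > 0`; dropping them bounds the reduced form
  -- below by a combination of the constraints, whose integral is zero.
  have h := integral_mono ((h1.const_mul (213 / 1444)).add (h2.const_mul (-407 / 1009)))
    ((hasOrder_ratioForm_reducedForm (ν := ν)).integrable ht) fun x => by
      simp only [Pi.add_apply]
      rw [mul_left_comm, mul_left_comm (-407 / 1009), ← mul_add]
      refine mul_le_mul_of_nonneg_left ?_ (heatDeriv_zero_pos ν ht x).le
      simp only [ratioForm]
      rw [reducedForm_eq]
      have : ∀ a b c m : ℝ, a + b ≤ a + b + 1 / 2036162 * m ^ 2 + 1 / 1784109085952 * c ^ 2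
          + 69485907702371 / 9000830338627840 * (heatRatio ν 1 t x ^ 3) ^ 2 := fun a b c m => by
        nlinarith [sq_nonneg m, sq_nonneg c, sq_nonneg (heatRatio ν 1 t x ^ 3)]
      exact this _ _ _ _
  simp only [Pi.add_apply] at h
  rw [integral_add (h1.const_mul _) (h2.const_mul _), integral_const_mul, integral_const_mul,
    integral_constraintOne ht, integral_constraintTwo ht] at h
  simpa using h

lemma HasOrder.integrable_mul_log {q : ℝ → ℝ → ℝ} (hq : HasOrder ν 6 q) {t : ℝ} (ht : 0 < t)
    (hfin : Integrable fun x => heatDeriv ν 0 t x * surprisal ν t x) :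
    Integrable fun x => heatDeriv ν 0 t x * q t x * (Real.log (heatDeriv ν 0 t x) + 1) := by
  have h1 := hq.integrable ht
  have hlog : Continuous fun x => Real.log (heatDeriv ν 0 t x) :=
    (continuous_heatDeriv ν ht 0).log fun x => (heatDeriv_zero_pos ν ht x).ne'
  obtain ⟨C, hC, hb⟩ := hq.exists_bound (b := t) ht
  obtain ⟨c, hc, hl⟩ := exists_abs_log_heat_le ν (b := t) ht
  refine ((((integrable_momentDensity ν ht).const_mul (c + 1)).add
    (integrable_momentDensity_mul_surprisal ν ht ht hfin)).const_mul C).mono'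
    (h1.1.mul (hlog.add continuous_const).aestronglyMeasurable)
    (Filter.Eventually.of_forall fun x => ?_)
  rw [norm_mul]
  have h2 : ‖Real.log (heatDeriv ν 0 t x) + 1‖ ≤ c + surprisal ν t x + 1 :=
    (norm_add_le _ _).trans (by simpa using hl t ⟨le_rfl, le_rfl⟩ x)
  refine (mul_le_mul (hb t ⟨le_rfl, le_rfl⟩ x) h2 (norm_nonneg _)
    (mul_nonneg hC (momentDensity_pos ν ht x).le)).trans_eq ?_
  simp only [Pi.add_apply]
  ring

/-- De Bruijn's identity. -/
lemma hasDerivAt_integral_negMulLog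
    (hfin : ∀ t, 0 < t → Integrable fun x => heatDeriv ν 0 t x * surprisal ν t x)
    {t : ℝ} (ht : 0 < t) :
    HasDerivAt (fun t => ∫ x, -(heatDeriv ν 0 t x * Real.log (heatDeriv ν 0 t x)))
      (1 / 2 * ∫ x, heatDeriv ν 0 t x * fisherForm ν t x) t := by
  have o1 : HasOrder ν 6 (heatRatio ν 1) :=
    (hasOrder_heatRatio (by norm_num)).mono (by norm_num)
  have o2 := hasOrder_two (ν := ν)
  set a := t / 2 with ha
  have ha0 : 0 < a := half_pos ht
  have hs : Set.Icc a (2 * t) ∈ nhds t := Icc_mem_nhds (by linarith) (by linarith)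
  have hlog : ∀ s, 0 < s → Continuous fun x => Real.log (heatDeriv ν 0 s x) := fun s hs =>
    (continuous_heatDeriv ν hs 0).log fun x => (heatDeriv_zero_pos ν hs x).ne'
  obtain ⟨C, hC, hb⟩ := o2.exists_bound (b := 2 * t) ha0
  obtain ⟨c, hc, hl⟩ := exists_abs_log_heat_le ν (b := 2 * t) ha0
  have hderiv := (hasDerivAt_integral_of_dominated_loc_of_deriv_le (μ := volume)
    (F := fun t x => -(heatDeriv ν 0 t x * Real.log (heatDeriv ν 0 t x)))
    (F' := fun t x => -1 / 2 *
      (heatDeriv ν 0 t x * heatRatio ν 2 t x * (Real.log (heatDeriv ν 0 t x) + 1)))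
    -- The surprisal decreases in time, so its value at the left endpoint `a` dominates on the whole
    -- interval.
    (bound := fun x => C * ((c + 1) * momentDensity ν (2 * t) x
      + momentDensity ν (2 * t) x * surprisal ν a x)) (x₀ := t) hs
    (by
      filter_upwards [hs] with s hs
      have hs0 := ha0.trans_le hs.1
      exact ((continuous_heatDeriv ν hs0 0).mul (hlog s hs0)).neg.aestronglyMeasurable)
    (by
      have h1 := (integrable_heatDeriv_zero ν ht).const_mul
        (Real.log (Real.sqrt (2 * Real.pi * t)))
      refine (h1.add (hfin t ht)).congr (Filter.Eventually.of_forall fun x => ?_)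
      simp only [Pi.add_apply, log_heatDeriv_zero ν ht]
      ring)
    ((o2.integrable_mul_log ht (hfin t ht)).const_mul _).1
    (Filter.Eventually.of_forall fun x s hs => by
      have h2 : ‖Real.log (heatDeriv ν 0 s x) + 1‖ ≤ c + surprisal ν a x + 1 :=
        (norm_add_le _ _).trans (by simpa using hl s hs x)
      rw [norm_mul, norm_mul]
      have h3 := mul_le_mul (hb s hs x) h2 (norm_nonneg _)
        (mul_nonneg hC (momentDensity_pos ν (by positivity) x).le)
      have h4 : ‖(-1 / 2 : ℝ)‖ ≤ 1 := by norm_num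
      calc _ ≤ ‖heatDeriv ν 0 s x * heatRatio ν 2 s x‖ *
            ‖Real.log (heatDeriv ν 0 s x) + 1‖ := mul_le_of_le_one_left (by positivity) h4
        _ ≤ _ := h3
        _ = _ := by ring)
    ((((integrable_momentDensity ν (by positivity)).const_mul (c + 1)).add
      (integrable_momentDensity_mul_surprisal ν ha0 (by positivity) (hfin a ha0))).const_mul C)
    (Filter.Eventually.of_forall fun x s hs => by
      have hs0 := ha0.trans_le hs.1
      refine (((Real.hasDerivAt_mul_log (heatDeriv_zero_pos ν hs0 x).ne').comp s
        (hasDerivAt_heat_time hs0 x)).neg).congr_deriv ?_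
      ring)).2
  refine hderiv.congr_deriv ?_
  rw [integral_const_mul]
  -- The primitive is `f_1 (log f + 1)`, with derivative `f_2 (log f + 1) + f_1² / f`; this
  -- exchanges the logarithmic term for the Fisher information.
  have hzero : ∫ x, (heatDeriv ν 0 t x * heatRatio ν 2 t x * (Real.log (heatDeriv ν 0 t x) + 1)
      + heatDeriv ν 0 t x * fisherForm ν t x) = 0 := by
    refine integral_eq_zero_of_hasDerivAt_of_integrable
      (f := fun x => heatDeriv ν 0 t x * heatRatio ν 1 t x * (Real.log (heatDeriv ν 0 t x) + 1))
      (fun x => ?_) ((o2.integrable_mul_log ht (hfin t ht)).add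
        (hasOrder_fisherForm.integrable ht)) (o1.integrable_mul_log ht (hfin t ht))
    have h0 := (heatDeriv_zero_pos ν ht x).ne'
    refine (((hasDerivAt_heat_space ht x).mul (hasDerivAt_heatRatio_space 1 ht x)).mul
      (((hasDerivAt_heat_space ht x).log h0).add_const 1)).congr_deriv ?_
    simp only [fisherForm, Pi.mul_apply]
    field_simp
    ring
  rw [integral_add (o2.integrable_mul_log ht (hfin t ht))
    (hasOrder_fisherForm.integrable ht)] at hzero
  linarith

end

/-! ### The law of `X + Z_t`: its density is the heat flow of the law of `X`. -/

section

variable (ν : Measure ℝ) [IsProbabilityMeasure ν]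

lemma gaussianPDF_zero_eq {t : ℝ} (ht : 0 < t) (u : ℝ) :
    gaussianPDF 0 t.toNNReal u = ENNReal.ofReal (gaussDeriv t u 0) := by
  simp [gaussianPDF, gaussianPDFReal, gaussDeriv, Real.coe_toNNReal t ht.le]

lemma conv_gaussianReal_eq_withDensity {t : ℝ} (ht : 0 < t) :
    ν ∗ gaussianReal 0 t.toNNReal =
      volume.withDensity fun x => ENNReal.ofReal (heatDeriv ν 0 t x) := by
  have mG : Measurable fun u => ENNReal.ofReal (gaussDeriv t u 0) :=
    (continuous_gaussDeriv t 0).measurable.ennreal_ofReal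
  have hv : t.toNNReal ≠ 0 := by simpa using ht
  ext s hs
  set f : ℝ → ENNReal := s.indicator 1 with hf
  have mf : Measurable f := measurable_one.indicator hs
  calc (ν ∗ gaussianReal 0 t.toNNReal) s
      = ∫⁻ z, f z ∂(ν ∗ gaussianReal 0 t.toNNReal) := (lintegral_indicator_one hs).symm
    _ = ∫⁻ y, (∫⁻ u, f (y + u) ∂(gaussianReal 0 t.toNNReal)) ∂ν := Measure.lintegral_conv mf
    _ = ∫⁻ y, (∫⁻ x, ENNReal.ofReal (gaussDeriv t (x - y) 0) * f x) ∂ν := by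
        refine lintegral_congr fun y => ?_
        rw [gaussianReal_of_var_ne_zero 0 hv, lintegral_withDensity_eq_lintegral_mul _
          (measurable_gaussianPDF 0 _) (g := fun u => f (y + u)) (mf.comp (measurable_const_add y)),
          ← lintegral_add_right_eq_self (fun x => _ * f x) y]
        refine lintegral_congr fun u => ?_
        rw [Pi.mul_apply, gaussianPDF_zero_eq ht, add_sub_cancel_right, add_comm y]
    _ = ∫⁻ x, ∫⁻ y, ENNReal.ofReal (gaussDeriv t (x - y) 0) * f x ∂ν := by
        refine lintegral_lintegral_swap
          (f := fun y x => ENNReal.ofReal (gaussDeriv t (x - y) 0) * f x) ?_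
        exact ((mG.comp (measurable_snd.sub measurable_fst)).mul
          (mf.comp measurable_snd)).aemeasurable
    _ = ∫⁻ x, s.indicator (fun x => ENNReal.ofReal (heatDeriv ν 0 t x)) x := by
        refine lintegral_congr fun x => ?_
        have e : ENNReal.ofReal (heatDeriv ν 0 t x) =
            ∫⁻ y, ENNReal.ofReal (gaussDeriv t (x - y) 0) ∂ν :=
          ofReal_integral_eq_lintegral_ofReal (integrable_gaussDeriv_sub ν ht 0 x)
            (Filter.Eventually.of_forall fun y => (gaussDeriv_zero_pos ht _).le)
        rw [lintegral_mul_const _ (f := fun y => ENNReal.ofReal (gaussDeriv t (x - y) 0))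
            (mG.comp (measurable_const.sub measurable_id)), ← e]
        by_cases hx : x ∈ s <;> simp [hf, hx]
    _ = _ := by rw [lintegral_indicator hs, withDensity_apply _ hs]

end

section

variable {Ω : Type*} [MeasurableSpace Ω] {P : Measure Ω} [IsProbabilityMeasure P] {X Y : Ω → ℝ}

lemma heatDensity_eq_heatDeriv (hX : HasPDF X P volume) :
    heatDensity P X = heatDeriv (P.map X) 0 := by
  ext t x
  have hc : Continuous fun y : ℝ => Real.exp (-(x - y) ^ 2 / (2 * t)) := by fun_prop
  rw [heatDensity, heatDeriv_zero_eq, expMoment]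
  congr 1
  rw [integral_map hX.aemeasurable hc.aestronglyMeasurable,
    ← pdf.integral_pdf_smul (X := X) (μ := volume) hc.aestronglyMeasurable]
  rfl

lemma iteratedDeriv_heatDeriv (ν : Measure ℝ) [IsProbabilityMeasure ν] {t : ℝ} (ht : 0 < t)
    (k : ℕ) : iteratedDeriv k (heatDeriv ν 0 t) = heatDeriv ν k t := by
  induction k with
  | zero => exact iteratedDeriv_zero
  | succ k ih =>
    rw [iteratedDeriv_succ, ih]
    exact funext fun x => (hasDerivAt_heatDeriv_space ν ht k x).deriv

lemma jet_eq_heatDeriv (hX : HasPDF X P volume) [IsProbabilityMeasure (P.map X)] {t : ℝ}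
    (ht : 0 < t) (x : ℝ) : jet P X t x = fun k => heatDeriv (P.map X) k t x := by
  ext k
  rw [jet, heatDensity_eq_heatDeriv hX, iteratedDeriv_heatDeriv _ ht]

lemma contDiff_heatDeriv (ν : Measure ℝ) [IsProbabilityMeasure ν] {t : ℝ} (ht : 0 < t)
    (n k : ℕ) : ContDiff ℝ n (heatDeriv ν k t) := by
  induction n generalizing k with
  | zero => exact contDiff_zero.2 (continuous_heatDeriv ν ht k)
  | succ n ih =>
    push_cast
    rw [contDiff_succ_iff_deriv]
    refine ⟨fun x => (hasDerivAt_heatDeriv_space ν ht k x).differentiableAt, by simp, ?_⟩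
    rw [funext fun x => (hasDerivAt_heatDeriv_space ν ht k x).deriv]
    exact ih (k + 1)

lemma map_add_eq_withDensity {t : ℝ} (ht : 0 < t) (hX : AEMeasurable X P)
    [IsProbabilityMeasure (P.map X)] (hY : HasLaw Y (gaussianReal 0 t.toNNReal) P)
    (hXY : IndepFun X Y P) :
    P.map (X + Y) = volume.withDensity fun x => ENNReal.ofReal (heatDeriv (P.map X) 0 t x) := by
  rw [hXY.map_add_eq_map_conv_map₀ hX hY.aemeasurable, hY.map_eq,
    conv_gaussianReal_eq_withDensity _ ht]

lemma hasPDF_add_gaussian {t : ℝ} (ht : 0 < t) (hX : AEMeasurable X P)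
    [IsProbabilityMeasure (P.map X)] (hY : HasLaw Y (gaussianReal 0 t.toNNReal) P)
    (hXY : IndepFun X Y P) : HasPDF (X + Y) P volume :=
  hasPDF_of_map_eq_withDensity (hX.add hY.aemeasurable) _
    (continuous_heatDeriv _ ht 0).measurable.ennreal_ofReal.aemeasurable
    (map_add_eq_withDensity ht hX hY hXY)

lemma pdf_add_gaussian {t : ℝ} (ht : 0 < t) (hX : AEMeasurable X P)
    [IsProbabilityMeasure (P.map X)] (hY : HasLaw Y (gaussianReal 0 t.toNNReal) P)
    (hXY : IndepFun X Y P) :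
    pdf (X + Y) P volume =ᵐ[volume] fun x => ENNReal.ofReal (heatDeriv (P.map X) 0 t x) := by
  have := hasPDF_add_gaussian ht hX hY hXY
  exact (pdf.eq_of_map_eq_withDensity _
    (continuous_heatDeriv _ ht 0).measurable.ennreal_ofReal.aemeasurable).1
    (map_add_eq_withDensity ht hX hY hXY)

lemma entropyIntegrand_add_gaussian {t : ℝ} (ht : 0 < t) (hX : AEMeasurable X P)
    [IsProbabilityMeasure (P.map X)] (hY : HasLaw Y (gaussianReal 0 t.toNNReal) P)
    (hXY : IndepFun X Y P) :
    entropyIntegrand P (X + Y) =ᵐ[volume]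
      fun x => -(heatDeriv (P.map X) 0 t x * Real.log (heatDeriv (P.map X) 0 t x)) := by
  filter_upwards [pdf_add_gaussian ht hX hY hXY] with x hx
  rw [entropyIntegrand, hx, ENNReal.toReal_ofReal (heatDeriv_zero_pos _ ht x).le]

/-- The logarithm of the prefactor contributes only a multiple of `f`, which is integrable. -/
lemma integrable_negMulLog_iff (ν : Measure ℝ) [IsProbabilityMeasure ν] {t : ℝ} (ht : 0 < t) :
    Integrable (fun x => -(heatDeriv ν 0 t x * Real.log (heatDeriv ν 0 t x))) ↔
      Integrable fun x => heatDeriv ν 0 t x * surprisal ν t x := by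
  have h := (integrable_heatDeriv_zero ν ht).const_mul (Real.log (Real.sqrt (2 * Real.pi * t)))
  have e : (fun x => -(heatDeriv ν 0 t x * Real.log (heatDeriv ν 0 t x))) =
      (fun x => Real.log (Real.sqrt (2 * Real.pi * t)) * heatDeriv ν 0 t x) +
        fun x => heatDeriv ν 0 t x * surprisal ν t x := by
    ext x
    simp only [Pi.add_apply, log_heatDeriv_zero ν ht]
    ring
  rw [e]
  exact integrable_add_iff_integrable_right h

end

lemma formF_div_eq (ν : Measure ℝ) [IsProbabilityMeasure ν] {t : ℝ} (ht : 0 < t) (x : ℝ) :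
    formF (fun k => heatDeriv ν k t x) / heatDeriv ν 0 t x ^ 5 =
      heatDeriv ν 0 t x * (1 / 2 * fisherForm₂ ν t x) := by
  have h0 := (heatDeriv_zero_pos ν ht x).ne'
  simp only [formF, fisherForm₂, heatRatio]
  field_simp
  ring

/-- Each monomial `m_i` is `f³` times its counterpart in the ratios, so a form homogeneous of degree
2 gains `f^6`, and division by `f^5` leaves the weight `f`. -/
lemma atMonomials_div_eq (ν : Measure ℝ) [IsProbabilityMeasure ν] {t : ℝ} (ht : 0 < t) (x : ℝ)
    {Q : ℝ → ℝ → ℝ → ℝ} (hQ : ∀ c m₁ m₂ m₃, Q (c * m₁) (c * m₂) (c * m₃) = c ^ 2 * Q m₁ m₂ m₃) :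
    atMonomials Q (fun k => heatDeriv ν k t x) / heatDeriv ν 0 t x ^ 5 =
      heatDeriv ν 0 t x * ratioForm ν Q t x := by
  have h0 := (heatDeriv_zero_pos ν ht x).ne'
  have h := hQ (heatDeriv ν 0 t x ^ 3) (heatRatio ν 3 t x)
    (heatRatio ν 1 t x * heatRatio ν 2 t x) (heatRatio ν 1 t x ^ 3)
  rw [show heatDeriv ν 0 t x ^ 3 * heatRatio ν 3 t x =
      heatDeriv ν 0 t x ^ 2 * heatDeriv ν 3 t x by simp only [heatRatio]; field_simp,
    show heatDeriv ν 0 t x ^ 3 * (heatRatio ν 1 t x * heatRatio ν 2 t x) =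
      heatDeriv ν 0 t x * heatDeriv ν 1 t x * heatDeriv ν 2 t x by
        simp only [heatRatio]; field_simp,
    show heatDeriv ν 0 t x ^ 3 * heatRatio ν 1 t x ^ 3 = heatDeriv ν 1 t x ^ 3 by
      simp only [heatRatio]; field_simp] at h
  rw [atMonomials, h, ratioForm]
  field_simp

end

end EntropyD31

/-! ### The theorem, assembled for `ν` the law of `X`. -/

theorem mainTheorem4 {Ω : Type*} [MeasurableSpace Ω] (P : Measure Ω) [IsProbabilityMeasure P]
    (X : Ω → ℝ) (Z : ℝ → Ω → ℝ) (hX : HasPDF X P volume)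
    (hZ : ∀ t : ℝ, 0 < t → HasLaw (Z t) (gaussianReal 0 t.toNNReal) P)
    (hXZ : ∀ t : ℝ, 0 < t → IndepFun X (Z t) P)
    (hfin : ∃ t : ℝ, 0 < t ∧ Integrable (EntropyD31.entropyIntegrand P (X + Z t))) :
    -- `X_t` has density `p_t` and finite entropy, and `H(X_t)` is three times differentiable
    (∀ t : ℝ, 0 < t →
      HasPDF (X + Z t) P volume ∧
      (∀ᵐ x : ℝ, pdf (X + Z t) P volume x = ENNReal.ofReal (EntropyD31.heatDensity P X t x)) ∧
      Integrable (EntropyD31.entropyIntegrand P (X + Z t))) ∧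
    ContDiffOn ℝ 3 (fun t : ℝ => EntropyD31.entropy P (X + Z t)) (Set.Ioi 0) ∧
    -- the inequality `D(3,1)`
    (∀ t : ℝ, 0 < t →
      0 ≤ iteratedDeriv 3 (fun s : ℝ => EntropyD31.entropy P (X + Z s)) t) ∧
    -- the third derivative is the integral of `F_{3,1} / f⁵`, and of its reduced form over `f⁵`
    (∀ t : ℝ, 0 < t →
      (∀ x : ℝ, 0 < EntropyD31.heatDensity P X t x) ∧
      ContDiff ℝ 5 (EntropyD31.heatDensity P X t) ∧
      Integrable (fun x : ℝ =>
        EntropyD31.formF (EntropyD31.jet P X t x) / EntropyD31.jet P X t x 0 ^ 5) ∧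
      iteratedDeriv 3 (fun s : ℝ => EntropyD31.entropy P (X + Z s)) t =
        ∫ x : ℝ, EntropyD31.formF (EntropyD31.jet P X t x) / EntropyD31.jet P X t x 0 ^ 5 ∧
      Integrable (fun x : ℝ =>
        EntropyD31.atMonomials EntropyD31.reducedForm (EntropyD31.jet P X t x) /
          EntropyD31.jet P X t x 0 ^ 5) ∧
      iteratedDeriv 3 (fun s : ℝ => EntropyD31.entropy P (X + Z s)) t =
        ∫ x : ℝ, EntropyD31.atMonomials EntropyD31.reducedForm (EntropyD31.jet P X t x) /
          EntropyD31.jet P X t x 0 ^ 5) ∧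
    -- the two quadratic constraints integrate to zero
    (∀ t : ℝ, 0 < t → ∀ R : ℝ → ℝ → ℝ → ℝ,
      R = EntropyD31.constraintOne ∨ R = EntropyD31.constraintTwo →
      Integrable (fun x : ℝ =>
        EntropyD31.atMonomials R (EntropyD31.jet P X t x) / EntropyD31.jet P X t x 0 ^ 5) ∧
      ∫ x : ℝ, EntropyD31.atMonomials R (EntropyD31.jet P X t x) /
        EntropyD31.jet P X t x 0 ^ 5 = 0) ∧
    -- the rational sum-of-squares representation modulo the two constraints
    (∀ m₁ m₂ m₃ : ℝ,
      EntropyD31.reducedForm m₁ m₂ m₃ =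
        213 / 1444 * EntropyD31.constraintOne m₁ m₂ m₃
          + (-407 / 1009) * EntropyD31.constraintTwo m₁ m₂ m₃
          + 1 / 2036162 * (1009 * m₁ + (-1009) * m₂ + 407 * m₃) ^ 2
          + 1 / 1784109085952 * (612256 * m₂ + (-486877) * m₃) ^ 2
          + 69485907702371 / 9000830338627840 * m₃ ^ 2) := by
  have hν : IsProbabilityMeasure (P.map X) := Measure.isProbabilityMeasure_map hX.aemeasurable
  set ν := P.map X with hνdef
  have hae := fun t (ht : 0 < t) =>
    EntropyD31.entropyIntegrand_add_gaussian ht hX.aemeasurable (hZ t ht) (hXZ t ht)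
  have hint : ∀ t, 0 < t → Integrable fun x =>
      EntropyD31.heatDeriv ν 0 t x * EntropyD31.surprisal ν t x := by
    obtain ⟨s, hs, h⟩ := hfin
    intro t ht
    exact EntropyD31.integrable_heat_mul_surprisal ν hs
      ((EntropyD31.integrable_negMulLog_iff ν hs).1 (h.congr (hae s hs))) ht
  have hentropy : ∀ t, 0 < t → EntropyD31.entropy P (X + Z t) =
      ∫ x, -(EntropyD31.heatDeriv ν 0 t x * Real.log (EntropyD31.heatDeriv ν 0 t x)) :=
    fun t ht => integral_congr_ae (hae t ht)
  have h₀ : ∀ t, 0 < t → HasDerivAt (fun t => EntropyD31.entropy P (X + Z t))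
      (1 / 2 * ∫ x, EntropyD31.heatDeriv ν 0 t x * EntropyD31.fisherForm ν t x) t :=
    -- The formula for the entropy is available only at positive times, so the two functions of time
    -- are compared near `t`.
    fun t ht => (EntropyD31.hasDerivAt_integral_negMulLog hint ht).congr_of_eventuallyEq <| by
      filter_upwards [Ioi_mem_nhds ht] with s hs
      exact hentropy s hs
  have h₁ := fun t (ht : 0 < t) =>
    (EntropyD31.hasDerivAt_integral_fisherForm (ν := ν) ht).const_mul (1 / 2)
  have h₂ := fun t (ht : 0 < t) =>
    (EntropyD31.hasDerivAt_integral_fisherForm₁ (ν := ν) ht).const_mul (1 / 2)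
  have h₃ := fun t (ht : 0 < t) => ((EntropyD31.hasOrder_fisherForm₂
    (ν := ν)).continuousAt_integral ht).const_mul (1 / 2)
  have hthird : ∀ t, 0 < t →
      iteratedDeriv 3 (fun s : ℝ => EntropyD31.entropy P (X + Z s)) t =
        ∫ x, EntropyD31.heatDeriv ν 0 t x * (1 / 2 * EntropyD31.fisherForm₂ ν t x) :=
    fun t ht => by
      rw [EntropyD31.iteratedDeriv_three_of_hasDerivAt h₀ h₁ h₂ ht, ← integral_const_mul]
      exact integral_congr_ae (Filter.Eventually.of_forall fun x => mul_left_comm _ _ _)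
  have hred := fun t (ht : 0 < t) =>
    EntropyD31.integral_fisherForm₂_eq_reducedForm (ν := ν) ht
  have hjet := fun t (ht : 0 < t) => EntropyD31.jet_eq_heatDeriv hX ht
  have hquad : ∀ t, 0 < t → ∀ Q : ℝ → ℝ → ℝ → ℝ,
      (∀ c m₁ m₂ m₃, Q (c * m₁) (c * m₂) (c * m₃) = c ^ 2 * Q m₁ m₂ m₃) →
      (fun x => EntropyD31.atMonomials Q (EntropyD31.jet P X t x) /
        EntropyD31.jet P X t x 0 ^ 5) =
      fun x => EntropyD31.heatDeriv ν 0 t x * EntropyD31.ratioForm ν Q t x :=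
    fun t ht Q hQ => funext fun x => by
      rw [hjet t ht]
      exact EntropyD31.atMonomials_div_eq ν ht x hQ
  have hred_hom : ∀ c m₁ m₂ m₃, EntropyD31.reducedForm (c * m₁) (c * m₂) (c * m₃) =
      c ^ 2 * EntropyD31.reducedForm m₁ m₂ m₃ := fun c m₁ m₂ m₃ => by
    simp only [EntropyD31.reducedForm]
    ring
  refine ⟨fun t ht => ⟨?_, ?_, ?_⟩, ?_, fun t ht => ?_, fun t ht => ⟨?_, ?_, ?_, ?_, ?_, ?_⟩,
    fun t ht R hR => ?_, EntropyD31.reducedForm_eq⟩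
  · exact EntropyD31.hasPDF_add_gaussian ht hX.aemeasurable (hZ t ht) (hXZ t ht)
  · rw [EntropyD31.heatDensity_eq_heatDeriv hX]
    exact EntropyD31.pdf_add_gaussian ht hX.aemeasurable (hZ t ht) (hXZ t ht)
  · exact ((EntropyD31.integrable_negMulLog_iff ν ht).2 (hint t ht)).congr (hae t ht).symm
  · exact EntropyD31.contDiffOn_three_of_hasDerivAt h₀ h₁ h₂ h₃
  · rw [hthird t ht, hred t ht]
    exact EntropyD31.integral_reducedForm_nonneg ht
  · rw [EntropyD31.heatDensity_eq_heatDeriv hX]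
    exact EntropyD31.heatDeriv_zero_pos ν ht
  · rw [EntropyD31.heatDensity_eq_heatDeriv hX]
    exact EntropyD31.contDiff_heatDeriv ν ht 5 0
  · simp only [hjet t ht, ← hνdef, EntropyD31.formF_div_eq ν ht]
    exact (EntropyD31.hasOrder_fisherForm₂.const_mul _).integrable ht
  · simp only [hthird t ht, hjet t ht, ← hνdef, EntropyD31.formF_div_eq ν ht]
  · rw [hquad t ht _ hred_hom]
    exact EntropyD31.hasOrder_ratioForm_reducedForm.integrable ht
  · rw [hquad t ht _ hred_hom, hthird t ht, hred t ht]
  · rcases hR with rfl | rfl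
    · rw [hquad t ht _ fun c m₁ m₂ m₃ => by simp only [EntropyD31.constraintOne]; ring]
      exact ⟨EntropyD31.hasOrder_ratioForm_constraintOne.integrable ht,
        EntropyD31.integral_constraintOne ht⟩
    · rw [hquad t ht _ fun c m₁ m₂ m₃ => by simp only [EntropyD31.constraintTwo]; ring]
      exact ⟨EntropyD31.hasOrder_ratioForm_constraintTwo.integrable ht,
        EntropyD31.integral_constraintTwo ht⟩
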